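/- Let $T>0$ and consider on $[0,T)$ the non-relativistic one-and-one-half-dimensional Vlasov–Maxwell system (unknowns $f(t,x,v)$, $E_1(t,x)$, $E_2(t,x)$, $B(t,x)$ with $t\in[0,T)$, $x\in\mathbb R$, $v=(v_1,v_2)\in\mathbb R^2$) $$\partial_t f+v_1\partial_x f+K\cdot\nabla_v f=0,\qquad K=(E_1+v_2B,\;E_2-v_1B),$$ $$\partial_xE_1=\rho:=\int f\,dv-b(x),\qquad \partial_tE_1=-j_1,\qquad \partial_tE_2=-\partial_xB-j_2,\qquad \partial_tB=-\partial_xE_2,\qquad j:=\int v f\,dv,$$ with $f(0,x,v)=f^0(x,v)$, $E_2(0,x)=E_2^0(x)$, $B(0,x)=B^0(x)$. Assume $f^0\in C^1_c(\mathbb R\times\mathbb R^2)$ with $f^0\ge 0$, $E_2^0,B^0\in C^1_c(\mathbb R)$, and $b\in C^1_c(\mathbb R)$ with the global neutrality condition $$\iint f^0(x,v)\,dv\,dx=\int b(x)\,dx.$$ Let $(f,E,B)$ be a $C^1$ solution on $[0,T)$: $f\in C^1([0,T)\times\mathbb R\times\mathbb R^2)$, $E_1,E_2,B\in C^1([0,T)\times\mathbb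 R)$, the integrals $\int f\,dv$ and $\int vf\,dv$ converge absolutely for every $(t,x)$, and all equations hold pointwise. Assume, as is usual for classical solutions, that the characteristics of the Vlasov equation reach the initial time: for every $(t,x,v)\in[0,T)\times\mathbb R\times\mathbb R^2$ there is a solution $(X,V_1,V_2)$ on $[0,t]$ of $\dot X=V_1$, $\dot V_1=E_1(s,X)+V_2B(s,X)$, $\dot V_2=E_2(s,X)-V_1B(s,X)$ with $X(t)=x$, $V(t)=v$. Then for every $\epsilon>0$ the quantity $|\partial_xf|+|\nabla_vf|$ is uniformly bounded on the set $$S_\epsilon=\bigl\{(t,x,v)\in[0,T)\times\mathbb R\times\mathbb R^2:\ \bigl||v_1|-1\bigr|>\epsilon\bigr\}.$$ -/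

import Mathlib

open MeasureTheory Set

namespace VlasovMaxwell

noncomputable section

/-- Charge density `ρ(t,x) = ∫ f(t,x,v) dv - b(x)`, with `v = (w.1, w.2) ∈ ℝ²`. -/
def rho (f : ℝ → ℝ → ℝ → ℝ → ℝ) (b : ℝ → ℝ) (t x : ℝ) : ℝ :=
  (∫ w : ℝ × ℝ, f t x w.1 w.2) - b x

/-- First component of the current density, `j₁(t,x) = ∫ v₁ f(t,x,v) dv`. -/
def j1 (f : ℝ → ℝ → ℝ → ℝ → ℝ) (t x : ℝ) : ℝ :=
  ∫ w : ℝ × ℝ, w.1 * f t x w.1 w.2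

/-- Second component of the current density, `j₂(t,x) = ∫ v₂ f(t,x,v) dv`. -/
def j2 (f : ℝ → ℝ → ℝ → ℝ → ℝ) (t x : ℝ) : ℝ :=
  ∫ w : ℝ × ℝ, w.2 * f t x w.1 w.2

/-- `K₁ = E₁ + v₂ B`. -/
def K1 (E1 B : ℝ → ℝ → ℝ) (t x v2 : ℝ) : ℝ := E1 t x + v2 * B t x

/-- `K₂ = E₂ - v₁ B`. -/
def K2 (E2 B : ℝ → ℝ → ℝ) (t x v1 : ℝ) : ℝ := E2 t x - v1 * B t x

/-- Time derivative on `[0,T)` (one-sided at `t = 0`). -/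
def dt (T : ℝ) (g : ℝ → ℝ) (t : ℝ) : ℝ := derivWithin g (Ico 0 T) t

/-- `∂ₓ f (t,x,v)`. -/
def dx (f : ℝ → ℝ → ℝ → ℝ → ℝ) (t x v1 v2 : ℝ) : ℝ := deriv (fun y => f t y v1 v2) x

/-- `∂_{v₁} f (t,x,v)`. -/
def dv1 (f : ℝ → ℝ → ℝ → ℝ → ℝ) (t x v1 v2 : ℝ) : ℝ := deriv (fun w => f t x w v2) v1

/-- `∂_{v₂} f (t,x,v)`. -/
def dv2 (f : ℝ → ℝ → ℝ → ℝ → ℝ) (t x v1 v2 : ℝ) : ℝ := deriv (fun w => f t x v1 w) v2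

/-- `(f, (E₁, E₂), B)` is a `C¹` solution on `[0,T)` of the non-relativistic
one-and-one-half-dimensional Vlasov-Maxwell system with background density `b`:
`f` is `C¹` on `[0,T) × ℝ × ℝ²`, the fields are `C¹` on `[0,T) × ℝ`, the integrals defining the
charge and current densities converge, and the equations hold pointwise. -/
structure IsC1Solution (T : ℝ) (b : ℝ → ℝ) (f : ℝ → ℝ → ℝ → ℝ → ℝ)
    (E1 E2 B : ℝ → ℝ → ℝ) : Prop where
  contDiff_f : ContDiffOn ℝ 1
    (fun p : ℝ × ℝ × ℝ × ℝ => f p.1 p.2.1 p.2.2.1 p.2.2.2) (Ico 0 T ×ˢ univ)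
  contDiff_E1 : ContDiffOn ℝ 1 (fun p : ℝ × ℝ => E1 p.1 p.2) (Ico 0 T ×ˢ univ)
  contDiff_E2 : ContDiffOn ℝ 1 (fun p : ℝ × ℝ => E2 p.1 p.2) (Ico 0 T ×ˢ univ)
  contDiff_B : ContDiffOn ℝ 1 (fun p : ℝ × ℝ => B p.1 p.2) (Ico 0 T ×ˢ univ)
  integrable_f : ∀ t ∈ Ico 0 T, ∀ x, Integrable (fun w : ℝ × ℝ => f t x w.1 w.2)
  integrable_v1f : ∀ t ∈ Ico 0 T, ∀ x, Integrable (fun w : ℝ × ℝ => w.1 * f t x w.1 w.2)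
  integrable_v2f : ∀ t ∈ Ico 0 T, ∀ x, Integrable (fun w : ℝ × ℝ => w.2 * f t x w.1 w.2)
  vlasov : ∀ t ∈ Ico 0 T, ∀ x v1 v2,
    dt T (fun s => f s x v1 v2) t + v1 * dx f t x v1 v2
      + (K1 E1 B t x v2 * dv1 f t x v1 v2 + K2 E2 B t x v1 * dv2 f t x v1 v2) = 0
  gauss : ∀ t ∈ Ico 0 T, ∀ x, deriv (fun y => E1 t y) x = rho f b t x
  ampere1 : ∀ t ∈ Ico 0 T, ∀ x, dt T (fun s => E1 s x) t = -j1 f t x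
  ampere2 : ∀ t ∈ Ico 0 T, ∀ x,
    dt T (fun s => E2 s x) t = -deriv (fun y => B t y) x - j2 f t x
  faraday : ∀ t ∈ Ico 0 T, ∀ x, dt T (fun s => B s x) t = -deriv (fun y => E2 t y) x

/-- `s ↦ (X s, V₁ s, V₂ s)` is, for `s ∈ [0,t]`, the characteristic curve of the Vlasov equation
that passes through `(x, v₁, v₂)` at time `t`. -/
structure IsCharacteristic (E1 E2 B : ℝ → ℝ → ℝ) (t x v1 v2 : ℝ) (X V1 V2 : ℝ → ℝ) : Prop where
  deriv_X : ∀ s ∈ Icc 0 t, HasDerivWithinAt X (V1 s) (Icc 0 t) s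
  deriv_V1 : ∀ s ∈ Icc 0 t, HasDerivWithinAt V1 (K1 E1 B s (X s) (V2 s)) (Icc 0 t) s
  deriv_V2 : ∀ s ∈ Icc 0 t, HasDerivWithinAt V2 (K2 E2 B s (X s) (V1 s)) (Icc 0 t) s
  X_end : X t = x
  V1_end : V1 t = v1
  V2_end : V2 t = v2

/-- Every characteristic can be followed back to the initial time: through each
`(t,x,v) ∈ [0,T) × ℝ × ℝ²` passes a characteristic curve defined on all of `[0,t]`
(no particle enters from infinity). -/
def CharacteristicsReachInitialTime (T : ℝ) (E1 E2 B : ℝ → ℝ → ℝ) : Prop :=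
  ∀ t ∈ Ico 0 T, ∀ x v1 v2, ∃ X V1 V2 : ℝ → ℝ, IsCharacteristic E1 E2 B t x v1 v2 X V1 V2

end

end VlasovMaxwell

/-!
The gradient of the density stays bounded away from the resonant velocities `v₁ = ±1`.

*Uniform bounds.* The density is constant along characteristics, hence takes values in
`[0, max f⁰]`. Gauss' and Ampère's laws make `N = E₁ + ∫ b` a primitive of the number density whose
values far away do not change in time, so mass and `E₁` are bounded (`abs_massPotential_le`).
Faraday's law gives a vector potential `A` with `∂ₓA = B`, `∂ₜA = -E₂`, and `v₂ + A` is conserved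
along characteristics. The components `E₂ ± B` travel along light rays and are forced by
`|j₂| ≤ |v₂|_max ∫ f dv`, so `A`, a space integral of `B`, grows at most by the time integral of
`|v₂|_max` times the mass: this is a linear Gronwall inequality for `|v₂|_max`
(`abs_v2_le_step`). With `v₂` bounded, `|j₂|` is at most linear in `|v₁|_max`, and a second linear
Gronwall inequality bounds `v₁` (`abs_v1_le_step`). A continuity argument in time removes the
assumption that the support is bounded (`exists_supportedIn`).

*Gradient.* Where the nonnegative `f` vanishes, so does its gradient; elsewhere the gradient is
bounded by the local Lipschitz constant of `f(a) ∘ (backward flow from t to a)`. If `|v₁|` is at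
distance `ε` from `1` at time `t`, then it stays at distance `ε / 2` on `[a, t]`, where `T - a`
depends only on `ε` and the bound on the force; at the fixed time `a < T` the density is Lipschitz
on its compact support. The flow from `t` to `a` is
Lipschitz uniformly in `t < T`: the dangerous term in the difference of two characteristics is
`∂ₓB ΔX`, but `∂ₓ(E₂ ± B) = (d/ds (E₂ ± B) + j₂) / (v₁ ∓ 1)` along a characteristic, so that this
term can be integrated by parts in time (`exists_uniform_lipschitz_characteristics`).
-/

open MeasureTheory Set

namespace VlasovMaxwell

variable {T : ℝ} {b : ℝ → ℝ} {f : ℝ → ℝ → ℝ → ℝ → ℝ} {E1 E2 B : ℝ → ℝ → ℝ}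

/-! ### Calculus on the time slab `[0, T) × E`, one-sided in time -/

/-- The time slab `[0, T) × E` on which the solution is defined. -/
abbrev slab (T : ℝ) (E : Type*) : Set (ℝ × E) := Ico 0 T ×ˢ univ

lemma uniqueDiffOn_slab (T : ℝ) (E : Type*) [NormedAddCommGroup E] [NormedSpace ℝ E] :
    UniqueDiffOn ℝ (slab T E) :=
  (uniqueDiffOn_Ico 0 T).prod uniqueDiffOn_univ

section Field

variable {g : ℝ → ℝ → ℝ}

/-- On the slab, the Fréchet derivative of a `C¹` field has the partial derivatives `dt` (one-sided
at `t = 0`) and `deriv` as its components. -/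
lemma hasFDerivWithinAt_field
    (hg : ContDiffOn ℝ 1 (fun p : ℝ × ℝ => g p.1 p.2) (slab T ℝ))
    {t : ℝ} (ht : t ∈ Ico 0 T) (x : ℝ) :
    fderivWithin ℝ (fun p : ℝ × ℝ => g p.1 p.2) (slab T ℝ) (t, x) (1, 0)
      = dt T (fun r => g r x) t ∧
    fderivWithin ℝ (fun p : ℝ × ℝ => g p.1 p.2) (slab T ℝ) (t, x) (0, 1) = deriv (g t) x ∧
    HasFDerivWithinAt (fun p : ℝ × ℝ => g p.1 p.2)
      (dt T (fun r => g r x) t • ContinuousLinearMap.fst ℝ ℝ ℝ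
        + deriv (g t) x • ContinuousLinearMap.snd ℝ ℝ ℝ) (slab T ℝ) (t, x) := by
  have hp : (t, x) ∈ slab T ℝ := ⟨ht, mem_univ _⟩
  have hF := (hg.differentiableOn one_ne_zero (t, x) hp).hasFDerivWithinAt
  set L := fderivWithin ℝ (fun p : ℝ × ℝ => g p.1 p.2) (slab T ℝ) (t, x) with hL
  have h1 : HasDerivWithinAt (fun r => g r x) (L (1, 0)) (Ico 0 T) t := by
    have hc : HasDerivWithinAt (fun r : ℝ => (r, x)) ((1 : ℝ), (0 : ℝ)) (Ico 0 T) t :=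
      (hasDerivWithinAt_id t _).prodMk (hasDerivWithinAt_const t _ x)
    exact HasFDerivWithinAt.comp_hasDerivWithinAt t hF hc (fun _ hr => mk_mem_prod hr (mem_univ _))
  have h2 : HasDerivWithinAt (fun y => g t y) (L (0, 1)) univ x := by
    have hc : HasDerivWithinAt (fun y : ℝ => (t, y)) ((0 : ℝ), (1 : ℝ)) univ x :=
      (hasDerivWithinAt_const x _ t).prodMk (hasDerivWithinAt_id x _)
    exact HasFDerivWithinAt.comp_hasDerivWithinAt x hF hc (fun _ _ => mk_mem_prod ht (mem_univ _))
  have e1 : L (1, 0) = dt T (fun r => g r x) t := (h1.derivWithin (uniqueDiffOn_Ico 0 T t ht)).symm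
  have e2 : L (0, 1) = deriv (g t) x := (hasDerivWithinAt_univ.1 h2).deriv.symm
  have e : L = dt T (fun r => g r x) t • ContinuousLinearMap.fst ℝ ℝ ℝ
      + deriv (g t) x • ContinuousLinearMap.snd ℝ ℝ ℝ := by
    ext
    · simp [e1]
    · simp [e2]
  exact ⟨e1, e2, e ▸ hF⟩

lemma hasDerivWithinAt_field_comp
    (hg : ContDiffOn ℝ 1 (fun p : ℝ × ℝ => g p.1 p.2) (slab T ℝ))
    {S : Set ℝ} (hS : S ⊆ Ico 0 T) {s : ℝ} (hs : s ∈ S) {X : ℝ → ℝ} {v : ℝ}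
    (hX : HasDerivWithinAt X v S s) :
    HasDerivWithinAt (fun r => g r (X r))
      (dt T (fun r => g r (X s)) s + v * deriv (g s) (X s)) S s := by
  have hF := (hasFDerivWithinAt_field hg (hS hs) (X s)).2.2
  have hc : HasDerivWithinAt (fun r : ℝ => (r, X r)) ((1 : ℝ), v) S s :=
    (hasDerivWithinAt_id s _).prodMk hX
  have := HasFDerivWithinAt.comp_hasDerivWithinAt (f := fun r : ℝ => (r, X r)) s hF hc
    (fun _ hr => mk_mem_prod (hS hr) (mem_univ _))
  exact this.congr_deriv (by simp [mul_comm])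

lemma hasDerivWithinAt_field_time
    (hg : ContDiffOn ℝ 1 (fun p : ℝ × ℝ => g p.1 p.2) (slab T ℝ))
    {S : Set ℝ} (hS : S ⊆ Ico 0 T) {s : ℝ} (hs : s ∈ S) (x : ℝ) :
    HasDerivWithinAt (fun r => g r x) (dt T (fun r => g r x) s) S s := by
  exact (hasDerivWithinAt_field_comp hg hS hs (hasDerivWithinAt_const s S x)).congr_deriv (by simp)

lemma hasDerivAt_field_space
    (hg : ContDiffOn ℝ 1 (fun p : ℝ × ℝ => g p.1 p.2) (slab T ℝ))
    {t : ℝ} (ht : t ∈ Ico 0 T) (x : ℝ) : HasDerivAt (g t) (deriv (g t) x) x := by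
  have hF := (hasFDerivWithinAt_field hg ht x).2.2
  have hc : HasDerivWithinAt (fun y : ℝ => (t, y)) ((0 : ℝ), (1 : ℝ)) univ x :=
    (hasDerivWithinAt_const x _ t).prodMk (hasDerivWithinAt_id x _)
  have h := HasFDerivWithinAt.comp_hasDerivWithinAt x hF hc (fun _ _ => mk_mem_prod ht (mem_univ _))
  exact (hasDerivWithinAt_univ.1 h).congr_deriv (by simp)

lemma continuousOn_field_deriv
    (hg : ContDiffOn ℝ 1 (fun p : ℝ × ℝ => g p.1 p.2) (slab T ℝ)) :
    ContinuousOn (fun p : ℝ × ℝ => deriv (g p.1) p.2) (slab T ℝ) := by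
  have h := (hg.continuousOn_fderivWithin (uniqueDiffOn_slab T ℝ) le_rfl).clm_apply
    (continuousOn_const (c := ((0 : ℝ), (1 : ℝ))))
  exact h.congr fun p hp => (hasFDerivWithinAt_field hg hp.1 p.2).2.1.symm

lemma continuousOn_field_dt
    (hg : ContDiffOn ℝ 1 (fun p : ℝ × ℝ => g p.1 p.2) (slab T ℝ)) :
    ContinuousOn (fun p : ℝ × ℝ => dt T (fun r => g r p.2) p.1) (slab T ℝ) := by
  have h := (hg.continuousOn_fderivWithin (uniqueDiffOn_slab T ℝ) le_rfl).clm_apply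
    (continuousOn_const (c := ((1 : ℝ), (0 : ℝ))))
  exact h.congr fun p hp => (hasFDerivWithinAt_field hg hp.1 p.2).1.symm

end Field

section Density

lemma hasFDerivWithinAt_density
    (hf : ContDiffOn ℝ 1 (fun p : ℝ × ℝ × ℝ × ℝ => f p.1 p.2.1 p.2.2.1 p.2.2.2)
      (slab T (ℝ × ℝ × ℝ)))
    {t : ℝ} (ht : t ∈ Ico 0 T) (x v1 v2 : ℝ) :
    ∃ L : ℝ × ℝ × ℝ × ℝ →L[ℝ] ℝ,
      L = fderivWithin ℝ (fun p : ℝ × ℝ × ℝ × ℝ => f p.1 p.2.1 p.2.2.1 p.2.2.2)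
        (slab T (ℝ × ℝ × ℝ)) (t, x, v1, v2) ∧
      HasFDerivWithinAt (fun p : ℝ × ℝ × ℝ × ℝ => f p.1 p.2.1 p.2.2.1 p.2.2.2) L
        (slab T (ℝ × ℝ × ℝ)) (t, x, v1, v2) ∧
      L (1, 0, 0, 0) = dt T (fun r => f r x v1 v2) t ∧ L (0, 1, 0, 0) = dx f t x v1 v2 ∧
      L (0, 0, 1, 0) = dv1 f t x v1 v2 ∧ L (0, 0, 0, 1) = dv2 f t x v1 v2 := by
  have hp : (t, x, v1, v2) ∈ slab T (ℝ × ℝ × ℝ) := ⟨ht, mem_univ _⟩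
  have hF := (hf.differentiableOn one_ne_zero (t, x, v1, v2) hp).hasFDerivWithinAt
  refine ⟨_, rfl, hF, ?_, ?_, ?_, ?_⟩
  · have hc : HasDerivWithinAt (fun r : ℝ => (r, x, v1, v2))
        ((1 : ℝ), (0 : ℝ), (0 : ℝ), (0 : ℝ)) (Ico 0 T) t :=
      (hasDerivWithinAt_id t _).prodMk (hasDerivWithinAt_const t _ (x, v1, v2))
    have h := HasFDerivWithinAt.comp_hasDerivWithinAt t hF hc (fun _ hr => mk_mem_prod hr (mem_univ _))
    exact (h.derivWithin (uniqueDiffOn_Ico 0 T t ht)).symm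
  · have hc : HasDerivWithinAt (fun y : ℝ => (t, y, v1, v2))
        ((0 : ℝ), (1 : ℝ), (0 : ℝ), (0 : ℝ)) univ x :=
      (hasDerivWithinAt_const x _ t).prodMk
        ((hasDerivWithinAt_id x _).prodMk (hasDerivWithinAt_const x _ (v1, v2)))
    have h := HasFDerivWithinAt.comp_hasDerivWithinAt x hF hc (fun _ _ => mk_mem_prod ht (mem_univ _))
    exact (hasDerivWithinAt_univ.1 h).deriv.symm
  · have hc : HasDerivWithinAt (fun y : ℝ => (t, x, y, v2))
        ((0 : ℝ), (0 : ℝ), (1 : ℝ), (0 : ℝ)) univ v1 :=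
      (hasDerivWithinAt_const v1 _ t).prodMk ((hasDerivWithinAt_const v1 _ x).prodMk
        ((hasDerivWithinAt_id v1 _).prodMk (hasDerivWithinAt_const v1 _ v2)))
    have h := HasFDerivWithinAt.comp_hasDerivWithinAt v1 hF hc (fun _ _ => mk_mem_prod ht (mem_univ _))
    exact (hasDerivWithinAt_univ.1 h).deriv.symm
  · have hc : HasDerivWithinAt (fun y : ℝ => (t, x, v1, y))
        ((0 : ℝ), (0 : ℝ), (0 : ℝ), (1 : ℝ)) univ v2 :=
      (hasDerivWithinAt_const v2 _ t).prodMk ((hasDerivWithinAt_const v2 _ x).prodMk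
        ((hasDerivWithinAt_const v2 _ v1).prodMk (hasDerivWithinAt_id v2 _)))
    have h := HasFDerivWithinAt.comp_hasDerivWithinAt v2 hF hc (fun _ _ => mk_mem_prod ht (mem_univ _))
    exact (hasDerivWithinAt_univ.1 h).deriv.symm

lemma hasDerivWithinAt_density_comp
    (hf : ContDiffOn ℝ 1 (fun p : ℝ × ℝ × ℝ × ℝ => f p.1 p.2.1 p.2.2.1 p.2.2.2)
      (slab T (ℝ × ℝ × ℝ)))
    {S : Set ℝ} (hS : S ⊆ Ico 0 T) {s : ℝ} (hs : s ∈ S) {X V1 V2 : ℝ → ℝ} {a b c : ℝ}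
    (hX : HasDerivWithinAt X a S s) (hV1 : HasDerivWithinAt V1 b S s)
    (hV2 : HasDerivWithinAt V2 c S s) :
    HasDerivWithinAt (fun r => f r (X r) (V1 r) (V2 r))
      (dt T (fun r => f r (X s) (V1 s) (V2 s)) s + a * dx f s (X s) (V1 s) (V2 s)
        + (b * dv1 f s (X s) (V1 s) (V2 s) + c * dv2 f s (X s) (V1 s) (V2 s))) S s := by
  obtain ⟨L, -, hL, h0, h1, h2, h3⟩ := hasFDerivWithinAt_density hf (hS hs) (X s) (V1 s) (V2 s)
  have hc : HasDerivWithinAt (fun r : ℝ => (r, X r, V1 r, V2 r)) ((1 : ℝ), a, b, c) S s :=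
    (hasDerivWithinAt_id s _).prodMk (hX.prodMk (hV1.prodMk hV2))
  have := HasFDerivWithinAt.comp_hasDerivWithinAt (f := fun r : ℝ => (r, X r, V1 r, V2 r)) s hL hc
    (fun _ hr => mk_mem_prod (hS hr) (mem_univ _))
  refine this.congr_deriv ?_
  have e : ((1 : ℝ), a, b, c) = (1, 0, 0, 0) + a • ((0 : ℝ), (1 : ℝ), (0 : ℝ), (0 : ℝ))
      + (b • ((0 : ℝ), (0 : ℝ), (1 : ℝ), (0 : ℝ)) + c • ((0 : ℝ), (0 : ℝ), (0 : ℝ), (1 : ℝ))) := by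
    simp
  rw [e]
  simp only [map_add, map_smul, h0, h1, h2, h3, smul_eq_mul]

/-- The phase-space gradient of a `C¹` density is bounded on compact parts of the slab. -/
lemma exists_bound_density_gradient
    (hf : ContDiffOn ℝ 1 (fun p : ℝ × ℝ × ℝ × ℝ => f p.1 p.2.1 p.2.2.1 p.2.2.2)
      (slab T (ℝ × ℝ × ℝ))) {t1 : ℝ} (ht1 : t1 < T) (R : ℝ) :
    ∃ M : ℝ, 0 ≤ M ∧ ∀ t ∈ Icc 0 t1, ∀ x v1 v2, |x| ≤ R → |v1| ≤ R → |v2| ≤ R →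
      ‖fderivWithin ℝ (fun p : ℝ × ℝ × ℝ × ℝ => f p.1 p.2.1 p.2.2.1 p.2.2.2)
        (slab T (ℝ × ℝ × ℝ)) (t, x, v1, v2)‖ ≤ M ∧
      |dx f t x v1 v2| ≤ M ∧ |dv1 f t x v1 v2| ≤ M ∧ |dv2 f t x v1 v2| ≤ M := by
  set K : Set (ℝ × ℝ × ℝ × ℝ) := Icc 0 t1 ×ˢ Icc (-R) R ×ˢ Icc (-R) R ×ˢ Icc (-R) R with hK
  have hKc : IsCompact K :=
    isCompact_Icc.prod (isCompact_Icc.prod (isCompact_Icc.prod isCompact_Icc))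
  have hKs : K ⊆ slab T (ℝ × ℝ × ℝ) := fun p hp => ⟨⟨hp.1.1, hp.1.2.trans_lt ht1⟩, mem_univ _⟩
  obtain ⟨M, hM⟩ := hKc.exists_bound_of_continuousOn
    ((hf.continuousOn_fderivWithin (uniqueDiffOn_slab T _) le_rfl).mono hKs)
  refine ⟨max M 0, le_max_right _ _, fun t ht x v1 v2 hx h1 h2 => ?_⟩
  have hb := hM (t, x, v1, v2) ⟨ht, abs_le.1 hx, abs_le.1 h1, abs_le.1 h2⟩
  obtain ⟨L, hLe, -, -, e1, e2, e3⟩ :=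
    hasFDerivWithinAt_density hf ⟨ht.1, ht.2.trans_lt ht1⟩ x v1 v2
  rw [← hLe] at hb ⊢
  have key : ∀ e : ℝ × ℝ × ℝ × ℝ, ‖e‖ ≤ 1 → |L e| ≤ max M 0 := fun e he => by
    have := L.le_opNorm_of_le he
    rw [mul_one, Real.norm_eq_abs] at this
    exact this.trans (hb.trans (le_max_left _ _))
  refine ⟨hb.trans (le_max_left _ _), ?_, ?_, ?_⟩
  · rw [← e1]; exact key _ (by simp [Prod.norm_def])
  · rw [← e2]; exact key _ (by simp [Prod.norm_def])
  · rw [← e3]; exact key _ (by simp [Prod.norm_def])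

end Density

/-! ### The density along characteristics -/

lemma Icc_subset_Ico_of_lt {t : ℝ} (ht : t < T) : Icc 0 t ⊆ Ico 0 T :=
  fun _ hs => ⟨hs.1, hs.2.trans_lt ht⟩

lemma density_eq_of_isCharacteristic (hsol : IsC1Solution T b f E1 E2 B) {t x v1 v2 : ℝ}
    (ht : t < T) {X V1 V2 : ℝ → ℝ} (hc : IsCharacteristic E1 E2 B t x v1 v2 X V1 V2)
    {s : ℝ} (hs : s ∈ Icc 0 t) : f s (X s) (V1 s) (V2 s) = f t x v1 v2 := by
  have hsub := Icc_subset_Ico_of_lt ht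
  have hd : ∀ r ∈ Icc 0 t, HasDerivWithinAt (fun r => f r (X r) (V1 r) (V2 r)) 0 (Icc 0 t) r := by
    intro r hr
    refine (hasDerivWithinAt_density_comp hsol.contDiff_f hsub hr (hc.deriv_X r hr)
      (hc.deriv_V1 r hr) (hc.deriv_V2 r hr)).congr_deriv ?_
    exact hsol.vlasov r (hsub hr) _ _ _
  have key := fun r hr => (convex_Icc 0 t).norm_image_sub_le_of_norm_hasDerivWithin_le
    (C := 0) (x := s) (y := r) hd (by simp) hs hr
  have h1 := key t ⟨hs.1.trans hs.2, le_rfl⟩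
  rw [zero_mul, norm_le_zero_iff, sub_eq_zero] at h1
  rw [hc.X_end, hc.V1_end, hc.V2_end] at h1
  exact h1.symm

/-- Bounds on the initial state `f(0)`, `E₂(0)`, `B(0)` and on the background density `b`, in the
form in which they enter the a priori estimates: `F₀` bounds the values, `R₀` the supports. -/
structure HasInitialBounds (b : ℝ → ℝ) (f : ℝ → ℝ → ℝ → ℝ → ℝ) (E2 B : ℝ → ℝ → ℝ)
    (R0 F0 : ℝ) : Prop where
  R0_nonneg : 0 ≤ R0
  f_nonneg : ∀ x v1 v2, 0 ≤ f 0 x v1 v2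
  f_le : ∀ x v1 v2, f 0 x v1 v2 ≤ F0
  f_supp : ∀ x v1 v2, f 0 x v1 v2 ≠ 0 → |x| ≤ R0 ∧ |v1| ≤ R0 ∧ |v2| ≤ R0
  E2_le : ∀ x, |E2 0 x| ≤ F0
  B_le : ∀ x, |B 0 x| ≤ F0
  E2_supp : ∀ x, R0 < |x| → E2 0 x = 0
  B_supp : ∀ x, R0 < |x| → B 0 x = 0
  b_cont : Continuous b
  b_supp : HasCompactSupport b

namespace HasInitialBounds

variable {R0 F0 : ℝ}

lemma F0_nonneg (hI : HasInitialBounds b f E2 B R0 F0) : 0 ≤ F0 :=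
  (hI.f_nonneg 0 0 0).trans (hI.f_le 0 0 0)

lemma density_mem_Icc (hI : HasInitialBounds b f E2 B R0 F0) (hsol : IsC1Solution T b f E1 E2 B)
    (hchar : CharacteristicsReachInitialTime T E1 E2 B) {t : ℝ} (ht : t ∈ Ico 0 T)
    (x v1 v2 : ℝ) : f t x v1 v2 ∈ Icc 0 F0 := by
  obtain ⟨X, V1, V2, hc⟩ := hchar t ht x v1 v2
  rw [← density_eq_of_isCharacteristic hsol ht.2 hc ⟨le_rfl, ht.1⟩]
  exact ⟨hI.f_nonneg _ _ _, hI.f_le _ _ _⟩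

end HasInitialBounds

/-- A nonnegative density has vanishing phase-space gradient wherever it vanishes. -/
lemma gradient_eq_zero_of_density_eq_zero {t : ℝ} (hf : ∀ x v1 v2, 0 ≤ f t x v1 v2)
    {x v1 v2 : ℝ} (h0 : f t x v1 v2 = 0) :
    dx f t x v1 v2 = 0 ∧ dv1 f t x v1 v2 = 0 ∧ dv2 f t x v1 v2 = 0 := by
  refine ⟨IsLocalMin.deriv_eq_zero (.of_forall fun y => ?_),
    IsLocalMin.deriv_eq_zero (.of_forall fun y => ?_),
    IsLocalMin.deriv_eq_zero (.of_forall fun y => ?_)⟩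
  all_goals simpa only [h0] using hf _ _ _

/-! ### Conservation of mass and the longitudinal field -/

/-- The number density `∫ f dv`. -/
noncomputable def numDensity (f : ℝ → ℝ → ℝ → ℝ → ℝ) (t x : ℝ) : ℝ :=
  ∫ w : ℝ × ℝ, f t x w.1 w.2

/-- `N(t,x) = E₁(t,x) + ∫₀ˣ b`, a primitive in `x` of the number density. -/
noncomputable def massPotential (b : ℝ → ℝ) (E1 : ℝ → ℝ → ℝ) (t x : ℝ) : ℝ :=
  E1 t x + ∫ y in (0 : ℝ)..x, b y

lemma hasDerivAt_massPotential (hsol : IsC1Solution T b f E1 E2 B) (hb : Continuous b)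
    {t : ℝ} (ht : t ∈ Ico 0 T) (x : ℝ) :
    HasDerivAt (massPotential b E1 t) (numDensity f t x) x := by
  have h := (hasDerivAt_field_space hsol.contDiff_E1 ht x).add
    (intervalIntegral.integral_hasDerivAt_right (hb.intervalIntegrable 0 x)
      (hb.stronglyMeasurableAtFilter _ _) hb.continuousAt)
  refine h.congr_deriv ?_
  have := hsol.gauss t ht x
  rw [show deriv (E1 t) x = rho f b t x from this, rho, numDensity]
  ring

lemma continuous_numDensity (hsol : IsC1Solution T b f E1 E2 B) (hb : Continuous b)
    {t : ℝ} (ht : t ∈ Ico 0 T) : Continuous (numDensity f t) := by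
  have h : numDensity f t = fun x => deriv (E1 t) x + b x := by
    ext x
    rw [show deriv (E1 t) x = rho f b t x from hsol.gauss t ht x, rho, numDensity]
    ring
  rw [h]
  refine Continuous.add ?_ hb
  have := (continuousOn_field_deriv hsol.contDiff_E1).comp
    (f := fun x : ℝ => (t, x)) (s := univ) (by fun_prop) (fun x _ => ⟨ht, mem_univ _⟩)
  exact continuousOn_univ.1 this

lemma integral_numDensity (hsol : IsC1Solution T b f E1 E2 B) (hb : Continuous b)
    {t : ℝ} (ht : t ∈ Ico 0 T) (p q : ℝ) :
    ∫ y in p..q, numDensity f t y = massPotential b E1 t q - massPotential b E1 t p :=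
  intervalIntegral.integral_eq_sub_of_hasDerivAt
    (fun x _ => hasDerivAt_massPotential hsol hb ht x)
    ((continuous_numDensity hsol hb ht).intervalIntegrable p q)

/-- Up to time `t₁`, the density is supported in the cube of half-width `R`. -/
def SupportedIn (f : ℝ → ℝ → ℝ → ℝ → ℝ) (t1 R : ℝ) : Prop :=
  ∀ s ∈ Icc 0 t1, ∀ x v1 v2, f s x v1 v2 ≠ 0 → |x| ≤ R ∧ |v1| ≤ R ∧ |v2| ≤ R

namespace SupportedIn

variable {t1 R : ℝ}

lemma numDensity_eq_zero (h : SupportedIn f t1 R) {s : ℝ} (hs : s ∈ Icc 0 t1) {x : ℝ}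
    (hx : R < |x|) : numDensity f s x = 0 := by
  have : ∀ w : ℝ × ℝ, f s x w.1 w.2 = 0 := fun w => by
    by_contra hne
    exact absurd (h s hs _ _ _ hne).1 (not_le.2 hx)
  simp [numDensity, this]

lemma j1_eq_zero (h : SupportedIn f t1 R) {s : ℝ} (hs : s ∈ Icc 0 t1) {x : ℝ}
    (hx : R < |x|) : j1 f s x = 0 := by
  have : ∀ w : ℝ × ℝ, f s x w.1 w.2 = 0 := fun w => by
    by_contra hne
    exact absurd (h s hs _ _ _ hne).1 (not_le.2 hx)
  simp [j1, this]

lemma j2_eq_zero (h : SupportedIn f t1 R) {s : ℝ} (hs : s ∈ Icc 0 t1) {x : ℝ}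
    (hx : R < |x|) : j2 f s x = 0 := by
  have : ∀ w : ℝ × ℝ, f s x w.1 w.2 = 0 := fun w => by
    by_contra hne
    exact absurd (h s hs _ _ _ hne).1 (not_le.2 hx)
  simp [j2, this]

end SupportedIn

lemma exists_bound_massPotential_zero (hsol : IsC1Solution T b f E1 E2 B) (hT : 0 < T)
    {R0 F0 : ℝ} (hI : HasInitialBounds b f E2 B R0 F0) :
    ∃ c : ℝ, ∀ x, |massPotential b E1 0 x| ≤ c := by
  have h0 : (0 : ℝ) ∈ Ico 0 T := ⟨le_rfl, hT⟩
  have hsupp : SupportedIn f 0 R0 := fun s hs x v1 v2 hne => by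
    obtain rfl : s = 0 := le_antisymm hs.2 hs.1
    exact hI.f_supp _ _ _ hne
  have hint : Integrable (numDensity f 0) := by
    refine (continuous_numDensity hsol hI.b_cont h0).integrable_of_hasCompactSupport ?_
    refine HasCompactSupport.intro (K := Icc (-R0) R0) isCompact_Icc fun x hx => ?_
    refine hsupp.numDensity_eq_zero ⟨le_rfl, le_rfl⟩ ?_
    by_contra hle
    exact hx (abs_le.1 (not_lt.1 hle))
  refine ⟨|massPotential b E1 0 0| + ∫ y, |numDensity f 0 y|, fun x => ?_⟩
  have e := integral_numDensity hsol hI.b_cont h0 0 x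
  have : |∫ y in (0 : ℝ)..x, numDensity f 0 y| ≤ ∫ y, |numDensity f 0 y| := by
    rw [← Real.norm_eq_abs]
    refine intervalIntegral.norm_integral_le_integral_norm_uIoc.trans ?_
    exact setIntegral_le_integral hint.norm (.of_forall fun _ => norm_nonneg _)
  rw [e] at this
  calc _ = |massPotential b E1 0 0 + (massPotential b E1 0 x - massPotential b E1 0 0)| := by
        congr 1; ring
    _ ≤ _ := (abs_add_le _ _).trans (by gcongr)

/-- The bound on the mass potential is propagated in time: outside the support of the density the
current `j₁` vanishes, so `N` keeps its initial value there, and `N` is monotone in `x`. -/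
lemma abs_massPotential_le (hsol : IsC1Solution T b f E1 E2 B) (hb : Continuous b)
    (hf : ∀ t ∈ Ico 0 T, ∀ x v1 v2, 0 ≤ f t x v1 v2)
    {c : ℝ} (hc : ∀ x, |massPotential b E1 0 x| ≤ c) {t1 R : ℝ} (ht1 : t1 < T)
    (hsupp : SupportedIn f t1 R) {t : ℝ} (ht : t ∈ Icc 0 t1) (x : ℝ) :
    |massPotential b E1 t x| ≤ c := by
  have hsub := Icc_subset_Ico_of_lt ht1
  have hmono : Monotone (massPotential b E1 t) :=
    monotone_of_hasDerivAt_nonneg (fun y => hasDerivAt_massPotential hsol hb (hsub ht) y)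
      (fun y => integral_nonneg fun w => hf t (hsub ht) _ _ _)
  have hout : ∀ y, R < |y| → massPotential b E1 t y = massPotential b E1 0 y := by
    intro y hy
    have hd : ∀ r ∈ Icc 0 t1, HasDerivWithinAt (fun r => E1 r y) 0 (Icc 0 t1) r := fun r hr => by
      refine (hasDerivWithinAt_field_time hsol.contDiff_E1 hsub hr y).congr_deriv ?_
      rw [hsol.ampere1 r (hsub hr) y, hsupp.j1_eq_zero hr hy, neg_zero]
    have := (convex_Icc 0 t1).norm_image_sub_le_of_norm_hasDerivWithin_le (C := 0) hd (by simp)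
      ⟨le_rfl, ht.1.trans ht.2⟩ ht
    rw [zero_mul, norm_le_zero_iff, sub_eq_zero] at this
    simp only [massPotential]
    rw [this]
  set y := max |x| |R| + 1 with hy
  have hy0 : 0 < y := by positivity
  have hRy : R < y := by
    have := le_max_right |x| |R|
    have := le_abs_self R
    linarith
  have hxy : |x| ≤ y := by
    have := le_max_left |x| |R|
    linarith
  have h1 := hmono (abs_le.1 hxy).2
  have h2 := hmono (abs_le.1 hxy).1
  rw [hout y (by rwa [abs_of_pos hy0])] at h1
  rw [hout (-y) (by rwa [abs_neg, abs_of_pos hy0])] at h2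
  exact abs_le.2 ⟨(abs_le.1 (hc (-y))).1.trans h2, h1.trans (abs_le.1 (hc y)).2⟩

lemma integral_numDensity_le (hsol : IsC1Solution T b f E1 E2 B) (hb : Continuous b)
    {c t : ℝ} (ht : t ∈ Ico 0 T) (hc : ∀ x, |massPotential b E1 t x| ≤ c) (p q : ℝ) :
    ∫ y in p..q, numDensity f t y ≤ 2 * c := by
  rw [integral_numDensity hsol hb ht]
  linarith [(abs_le.1 (hc q)).2, (abs_le.1 (hc p)).1]

lemma abs_E1_le (hbi : Integrable b) {c t x : ℝ} (hc : |massPotential b E1 t x| ≤ c) :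
    |E1 t x| ≤ c + ∫ y, |b y| := by
  have : |∫ y in (0 : ℝ)..x, b y| ≤ ∫ y, |b y| := by
    rw [← Real.norm_eq_abs]
    refine intervalIntegral.norm_integral_le_integral_norm_uIoc.trans ?_
    exact setIntegral_le_integral hbi.norm (.of_forall fun _ => norm_nonneg _)
  calc |E1 t x| = |massPotential b E1 t x - ∫ y in (0 : ℝ)..x, b y| := by
        simp [massPotential]
    _ ≤ _ := (abs_sub _ _).trans (add_le_add hc this)

/-! ### The transverse fields along light rays -/

/-- The travelling component `E₂ + σ B` of the transverse field. For `σ = ±1` it is transported with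
velocity `σ` and forced by `-j₂`. -/
def travField (E2 B : ℝ → ℝ → ℝ) (σ t x : ℝ) : ℝ := E2 t x + σ * B t x

/-- The derivative of `E₂ + σ B` along a curve of velocity `v`: the factor `v - σ` measures how far
the curve is from being a light ray. -/
lemma hasDerivWithinAt_travField_comp (hsol : IsC1Solution T b f E1 E2 B) {σ : ℝ} (hσ : σ ^ 2 = 1)
    {S : Set ℝ} (hS : S ⊆ Ico 0 T) {s : ℝ} (hs : s ∈ S) {X : ℝ → ℝ} {v : ℝ}
    (hX : HasDerivWithinAt X v S s) :
    HasDerivWithinAt (fun r => travField E2 B σ r (X r))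
      (-j2 f s (X s) + (v - σ) * (deriv (E2 s) (X s) + σ * deriv (B s) (X s))) S s := by
  have h := (hasDerivWithinAt_field_comp hsol.contDiff_E2 hS hs hX).add
    ((hasDerivWithinAt_field_comp hsol.contDiff_B hS hs hX).const_mul σ)
  refine h.congr_deriv ?_
  rw [hsol.ampere2 s (hS hs), hsol.faraday s (hS hs)]
  linear_combination deriv (B s) (X s) * hσ

lemma continuousOn_j2 (hsol : IsC1Solution T b f E1 E2 B) :
    ContinuousOn (fun p : ℝ × ℝ => j2 f p.1 p.2) (slab T ℝ) := by
  refine ((continuousOn_field_dt hsol.contDiff_E2).neg.sub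
    (continuousOn_field_deriv hsol.contDiff_B)).congr fun p hp => ?_
  have := hsol.ampere2 p.1 hp.1 p.2
  simp only [Pi.neg_apply, Pi.sub_apply]
  rw [this]
  ring

lemma hasDerivWithinAt_travField_ray (hsol : IsC1Solution T b f E1 E2 B) {σ : ℝ} (hσ : σ ^ 2 = 1)
    {t : ℝ} (ht : t < T) (x : ℝ) {s : ℝ} (hs : s ∈ Icc 0 t) :
    HasDerivWithinAt (fun r => travField E2 B σ r (x - σ * (t - r)))
      (-j2 f s (x - σ * (t - s))) (Icc 0 t) s := by
  have hX : HasDerivWithinAt (fun r => x - σ * (t - r)) σ (Icc 0 t) s := by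
    have := (((hasDerivWithinAt_id s (Icc 0 t)).const_sub t).const_mul σ).const_sub x
    exact this.congr_deriv (by simp)
  exact (hasDerivWithinAt_travField_comp hsol hσ (Icc_subset_Ico_of_lt ht) hs hX).congr_deriv
    (by simp)

lemma continuousOn_j2_ray (hsol : IsC1Solution T b f E1 E2 B) (σ : ℝ) {t : ℝ} (ht : t < T) :
    ContinuousOn (fun p : ℝ × ℝ => j2 f p.2 (p.1 - σ * (t - p.2))) (univ ×ˢ Icc 0 t) :=
  (continuousOn_j2 hsol).comp (f := fun p : ℝ × ℝ => (p.2, p.1 - σ * (t - p.2))) (by fun_prop)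
    fun _ hp => ⟨Icc_subset_Ico_of_lt ht hp.2, mem_univ _⟩

lemma travField_eq_ray (hsol : IsC1Solution T b f E1 E2 B) {σ : ℝ} (hσ : σ ^ 2 = 1)
    {t : ℝ} (ht : t ∈ Ico 0 T) (x : ℝ) :
    travField E2 B σ t x = travField E2 B σ 0 (x - σ * t)
      - ∫ s in (0 : ℝ)..t, j2 f s (x - σ * (t - s)) := by
  have hd := fun s hs => hasDerivWithinAt_travField_ray hsol hσ ht.2 x (s := s) hs
  have hcont : ContinuousOn (fun s => j2 f s (x - σ * (t - s))) (Icc 0 t) :=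
    (continuousOn_j2_ray hsol σ ht.2).comp (f := fun s : ℝ => (x, s)) (by fun_prop)
      fun s hs => ⟨mem_univ _, hs⟩
  have h := intervalIntegral.integral_eq_sub_of_hasDerivAt_of_le ht.1
    (fun s hs => (hd s hs).continuousWithinAt)
    (fun s hs => (hd s (Ioo_subset_Icc_self hs)).hasDerivAt (Icc_mem_nhds hs.1 hs.2))
    (hcont.neg.intervalIntegrable_of_Icc ht.1)
  rw [intervalIntegral.integral_neg] at h
  simp only [sub_self, mul_zero, sub_zero] at h
  linarith

/-- Light travels with speed one: the travelling components vanish far from the supports of the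
data and of the density. -/
lemma travField_eq_zero (hsol : IsC1Solution T b f E1 E2 B) {R0 F0 : ℝ}
    (hI : HasInitialBounds b f E2 B R0 F0) {σ : ℝ} (hσ : |σ| = 1) {t1 R : ℝ}
    (ht1 : t1 < T) (hsupp : SupportedIn f t1 R) {t : ℝ} (ht : t ∈ Icc 0 t1) {x : ℝ}
    (hx : |R| + R0 + T < |x|) : travField E2 B σ t x = 0 := by
  have hσ2 : σ ^ 2 = 1 := by rw [← sq_abs, hσ, one_pow]
  have htT : t < T := ht.2.trans_lt ht1
  have far : ∀ r, 0 ≤ r → r ≤ t → |R| + R0 < |x - σ * r| := fun r h0 h1 => by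
    have h2 : |σ * r| = r := by rw [abs_mul, hσ, one_mul, abs_of_nonneg h0]
    have := abs_sub_abs_le_abs_sub x (σ * r)
    linarith
  rw [travField_eq_ray hsol hσ2 ⟨ht.1, htT⟩]
  have h0 : R0 < |x - σ * t| := (le_add_of_nonneg_left (abs_nonneg R)).trans_lt (far t ht.1 le_rfl)
  have hz : ∫ s in (0 : ℝ)..t, j2 f s (x - σ * (t - s)) = ∫ s in (0 : ℝ)..t, (0 : ℝ) := by
    refine intervalIntegral.integral_congr fun s hs => ?_
    rw [uIcc_of_le ht.1] at hs
    refine hsupp.j2_eq_zero ⟨hs.1, hs.2.trans ht.2⟩ ?_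
    have := far (t - s) (by linarith [hs.2]) (by linarith [hs.1])
    linarith [le_abs_self R, hI.R0_nonneg]
  rw [hz]
  simp [travField, hI.E2_supp _ h0, hI.B_supp _ h0]

/-- If `|v₂| ≤ Y` on the support of `f(s)`, then `|j₂| ≤ Y ∫ f dv`. -/
lemma abs_j2_le (hsol : IsC1Solution T b f E1 E2 B)
    (hf : ∀ t ∈ Ico 0 T, ∀ x v1 v2, 0 ≤ f t x v1 v2) {s : ℝ} (hs : s ∈ Ico 0 T) {Y : ℝ}
    (hY : ∀ x v1 v2, f s x v1 v2 ≠ 0 → |v2| ≤ Y) (x : ℝ) :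
    |j2 f s x| ≤ Y * numDensity f s x := by
  rw [numDensity, ← integral_const_mul, j2, ← Real.norm_eq_abs]
  refine norm_integral_le_of_norm_le ((hsol.integrable_f s hs x).const_mul Y)
    (.of_forall fun w => ?_)
  rw [norm_mul, Real.norm_eq_abs, Real.norm_eq_abs, abs_of_nonneg (hf s hs _ _ _)]
  by_cases h0 : f s x w.1 w.2 = 0
  · simp [h0]
  · exact mul_le_mul_of_nonneg_right (hY _ _ _ h0) (hf s hs _ _ _)

lemma integral_mul_exp_le {K l t : ℝ} (hK : 0 ≤ K) (hl : 0 < l) :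
    ∫ s in (0 : ℝ)..t, K * Real.exp (l * s) ≤ K / l * Real.exp (l * t) := by
  have hd : ∀ s ∈ uIcc 0 t, HasDerivAt (fun s => K / l * Real.exp (l * s))
      (K * Real.exp (l * s)) s := fun s _ => by
    have := (((hasDerivAt_id s).const_mul l).exp).const_mul (K / l)
    refine this.congr_deriv ?_
    simp only [id, mul_one]
    field_simp
  rw [intervalIntegral.integral_eq_sub_of_hasDerivAt hd
    (Continuous.intervalIntegrable (by fun_prop) _ _)]
  have : 0 ≤ K / l * Real.exp (l * 0) := by positivity
  linarith

/-- The total initial mass of the transverse fields. -/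
noncomputable def fieldMass (E2 B : ℝ → ℝ → ℝ) : ℝ := (∫ y, |E2 0 y|) + ∫ y, |B 0 y|

lemma continuous_field_space {g : ℝ → ℝ → ℝ}
    (hg : ContDiffOn ℝ 1 (fun p : ℝ × ℝ => g p.1 p.2) (slab T ℝ)) {t : ℝ} (ht : t ∈ Ico 0 T) :
    Continuous (g t) :=
  continuous_iff_continuousAt.2 fun x => (hasDerivAt_field_space hg ht x).continuousAt

lemma integrable_of_eq_zero_of_lt {g : ℝ → ℝ} (hg : Continuous g) {R : ℝ}
    (h : ∀ x, R < |x| → g x = 0) : Integrable g := by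
  refine hg.integrable_of_hasCompactSupport ?_
  refine HasCompactSupport.intro (K := Icc (-R) R) isCompact_Icc fun x hx => h x ?_
  by_contra hle
  exact hx (abs_le.1 (not_lt.1 hle))

lemma abs_integral_travField_zero_le (hsol : IsC1Solution T b f E1 E2 B) (hT : 0 < T) {R0 F0 : ℝ}
    (hI : HasInitialBounds b f E2 B R0 F0) {σ : ℝ} (hσ : |σ| = 1) (p q : ℝ) :
    |∫ y in p..q, travField E2 B σ 0 y| ≤ fieldMass E2 B := by
  have h0 : (0 : ℝ) ∈ Ico 0 T := ⟨le_rfl, hT⟩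
  have hiE := integrable_of_eq_zero_of_lt (continuous_field_space hsol.contDiff_E2 h0) hI.E2_supp
  have hiB := integrable_of_eq_zero_of_lt (continuous_field_space hsol.contDiff_B h0) hI.B_supp
  have hiG : Integrable (travField E2 B σ 0) := hiE.add (hiB.const_mul σ)
  rw [← Real.norm_eq_abs]
  refine intervalIntegral.norm_integral_le_integral_norm_uIoc.trans ?_
  refine (setIntegral_le_integral hiG.norm (.of_forall fun _ => norm_nonneg _)).trans ?_
  rw [fieldMass, ← integral_add hiE.abs hiB.abs]
  refine integral_mono hiG.norm (hiE.abs.add hiB.abs) fun y => ?_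
  refine (abs_add_le _ _).trans ?_
  simp [abs_mul, hσ]

/-- The integral of a travelling component over any interval is controlled by the mass: along the
light rays the forcing `j₂` is integrated in space, where `|j₂| ≤ |v₂|_max ∫ f dv`. -/
lemma abs_integral_travField_le (hsol : IsC1Solution T b f E1 E2 B) {R0 F0 : ℝ}
    (hI : HasInitialBounds b f E2 B R0 F0)
    (hf : ∀ t ∈ Ico 0 T, ∀ x v1 v2, 0 ≤ f t x v1 v2) {σ : ℝ} (hσ : |σ| = 1) {c K l t : ℝ}
    (ht : t ∈ Ico 0 T) (hc : ∀ s ∈ Icc 0 t, ∀ x, |massPotential b E1 s x| ≤ c)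
    (hK : 0 ≤ K) (hl : 0 < l)
    (hY : ∀ s ∈ Icc 0 t, ∀ x v1 v2, f s x v1 v2 ≠ 0 → |v2| ≤ K * Real.exp (l * s))
    {p q : ℝ} (hpq : p ≤ q) :
    |∫ y in p..q, travField E2 B σ t y| ≤ fieldMass E2 B + 2 * c * K / l * Real.exp (l * t) := by
  have hσ2 : σ ^ 2 = 1 := by rw [← sq_abs, hσ, one_pow]
  have hsub := Icc_subset_Ico_of_lt ht.2
  have h0 : (0 : ℝ) ∈ Ico 0 T := ⟨le_rfl, ht.1.trans_lt ht.2⟩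
  have hcE := continuous_field_space hsol.contDiff_E2 h0
  have hcB := continuous_field_space hsol.contDiff_B h0
  have hc0 : 0 ≤ c := (abs_nonneg _).trans (hc 0 ⟨le_rfl, ht.1⟩ 0)
  have hcG : Continuous (travField E2 B σ 0) := hcE.add (continuous_const.mul hcB)
  have hcj := continuousOn_j2_ray hsol σ ht.2
  have hIntOn : IntegrableOn (Function.uncurry fun y s => j2 f s (y - σ * (t - s)))
      (uIoc p q ×ˢ uIoc 0 t) := by
    have : IntegrableOn (fun p : ℝ × ℝ => j2 f p.2 (p.1 - σ * (t - p.2)))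
        (uIcc p q ×ˢ uIcc 0 t) := by
      refine ContinuousOn.integrableOn_compact (isCompact_uIcc.prod isCompact_uIcc)
        (hcj.mono (prod_mono (subset_univ _) ?_))
      rw [uIcc_of_le ht.1]
    exact this.mono_set (prod_mono uIoc_subset_uIcc uIoc_subset_uIcc)
  -- the contribution of the initial fields
  have hfirst : |∫ y in p..q, travField E2 B σ 0 (y - σ * t)| ≤ fieldMass E2 B := by
    rw [intervalIntegral.integral_comp_sub_right (fun y => travField E2 B σ 0 y)]
    exact abs_integral_travField_zero_le hsol h0.2 hI hσ _ _
  -- the contribution of the current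
  have hsecond : |∫ y in p..q, ∫ s in (0 : ℝ)..t, j2 f s (y - σ * (t - s))|
      ≤ 2 * c * K / l * Real.exp (l * t) := by
    rw [intervalIntegral_intervalIntegral_swap hIntOn, ← Real.norm_eq_abs]
    have hin : ∀ s ∈ Icc 0 t, ‖∫ y in p..q, j2 f s (y - σ * (t - s))‖
        ≤ 2 * c * K * Real.exp (l * s) := fun s hs => by
      rw [intervalIntegral.integral_comp_sub_right (fun y => j2 f s y)]
      have hle : p - σ * (t - s) ≤ q - σ * (t - s) := by linarith
      have hn := continuous_numDensity hsol hI.b_cont (hsub hs)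
      refine (intervalIntegral.norm_integral_le_of_norm_le hle
        (.of_forall fun y _ => abs_j2_le hsol hf (hsub hs) (hY s hs) y)
        ((hn.const_mul _).intervalIntegrable _ _)).trans ?_
      rw [intervalIntegral.integral_const_mul]
      have := integral_numDensity_le hsol hI.b_cont (hsub hs) (hc s hs)
        (p - σ * (t - s)) (q - σ * (t - s))
      calc _ ≤ K * Real.exp (l * s) * (2 * c) := by gcongr
        _ = _ := by ring
    refine (intervalIntegral.norm_integral_le_of_norm_le ht.1
      (.of_forall fun s hs => hin s (Ioc_subset_Icc_self hs))
      (Continuous.intervalIntegrable (by fun_prop) _ _)).trans ?_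
    exact integral_mul_exp_le (by positivity) hl
  have hi1 : IntervalIntegrable (fun y => travField E2 B σ 0 (y - σ * t)) volume p q :=
    (hcG.comp (by fun_prop)).intervalIntegrable _ _
  have hi3 : IntervalIntegrable (fun y => travField E2 B σ t y) volume p q := by
    have h1 := continuous_field_space hsol.contDiff_E2 ht
    have h2 := continuous_field_space hsol.contDiff_B ht
    exact (h1.add (continuous_const.mul h2)).intervalIntegrable _ _
  have hi2 : IntervalIntegrable (fun y => ∫ s in (0 : ℝ)..t, j2 f s (y - σ * (t - s)))
      volume p q := by
    refine (hi1.sub hi3).congr fun y _ => ?_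
    rw [travField_eq_ray hsol hσ2 ht y, sub_sub_cancel]
  have e : ∫ y in p..q, travField E2 B σ t y = (∫ y in p..q, travField E2 B σ 0 (y - σ * t))
      - ∫ y in p..q, ∫ s in (0 : ℝ)..t, j2 f s (y - σ * (t - s)) := by
    rw [← intervalIntegral.integral_sub hi1 hi2]
    exact intervalIntegral.integral_congr fun y _ => travField_eq_ray hsol hσ2 ht y
  rw [e]
  exact (abs_sub _ _).trans (add_le_add hfirst hsecond)

/-! ### The vector potential -/

/-- `A` is a vector potential on `[0, T) × ℝ`: `∂ₜA = -E₂` and `∂ₓA = B`. -/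
def IsPotential (T : ℝ) (E2 B : ℝ → ℝ → ℝ) (A : ℝ × ℝ → ℝ) : Prop :=
  ∀ p ∈ slab T ℝ, HasFDerivWithinAt A ((-E2 p.1 p.2) • ContinuousLinearMap.fst ℝ ℝ ℝ
        + B p.1 p.2 • ContinuousLinearMap.snd ℝ ℝ ℝ) (slab T ℝ) p

/-- By Faraday's law the one-form `-E₂ dt + B dx` is closed; a primitive is a vector potential. -/
lemma exists_isPotential (hsol : IsC1Solution T b f E1 E2 B) :
    ∃ A : ℝ × ℝ → ℝ, IsPotential T E2 B A := by
  have hconv : Convex ℝ (slab T ℝ) := (convex_Ico 0 T).prod convex_univ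
  refine hconv.exists_forall_hasFDerivWithinAt_of_hasFDerivWithinAt_symmetric
    (fun p hp => ((hasFDerivWithinAt_field hsol.contDiff_E2 hp.1 p.2).2.2.neg.smul_const
      (ContinuousLinearMap.fst ℝ ℝ ℝ)).add
      ((hasFDerivWithinAt_field hsol.contDiff_B hp.1 p.2).2.2.smul_const
        (ContinuousLinearMap.snd ℝ ℝ ℝ))) ?_
  intro p hp x _ y _
  simp only [hsol.faraday p.1 hp.1 p.2]
  simp
  ring

namespace IsPotential

variable {A : ℝ × ℝ → ℝ}

lemma hasDerivWithinAt_comp (hA : IsPotential T E2 B A) {S : Set ℝ} (hS : S ⊆ Ico 0 T) {s : ℝ}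
    (hs : s ∈ S) {X : ℝ → ℝ} {v : ℝ} (hX : HasDerivWithinAt X v S s) :
    HasDerivWithinAt (fun r => A (r, X r)) (-E2 s (X s) + v * B s (X s)) S s := by
  have hc : HasDerivWithinAt (fun r : ℝ => (r, X r)) ((1 : ℝ), v) S s :=
    (hasDerivWithinAt_id s _).prodMk hX
  have := HasFDerivWithinAt.comp_hasDerivWithinAt (f := fun r : ℝ => (r, X r)) s
    (hA (s, X s) ⟨hS hs, mem_univ _⟩) hc (fun _ hr => mk_mem_prod (hS hr) (mem_univ _))
  exact this.congr_deriv (by simp [mul_comm])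

lemma hasDerivAt_space (hA : IsPotential T E2 B A) {t : ℝ} (ht : t ∈ Ico 0 T) (x : ℝ) :
    HasDerivAt (fun y => A (t, y)) (B t x) x := by
  have hc : HasDerivWithinAt (fun y : ℝ => (t, y)) ((0 : ℝ), (1 : ℝ)) univ x :=
    (hasDerivWithinAt_const x _ t).prodMk (hasDerivWithinAt_id x _)
  have h := HasFDerivWithinAt.comp_hasDerivWithinAt x (hA (t, x) ⟨ht, mem_univ _⟩) hc
    (fun _ _ => mk_mem_prod ht (mem_univ _))
  exact (hasDerivWithinAt_univ.1 h).congr_deriv (by simp)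

/-- The canonical momentum `v₂ + A` is conserved along characteristics. -/
lemma momentum_conserved (hA : IsPotential T E2 B A) {t x v1 v2 : ℝ} (ht : t < T)
    {X V1 V2 : ℝ → ℝ} (hc : IsCharacteristic E1 E2 B t x v1 v2 X V1 V2) {s : ℝ}
    (hs : s ∈ Icc 0 t) : V2 s + A (s, X s) = v2 + A (t, x) := by
  have hd : ∀ r ∈ Icc 0 t, HasDerivWithinAt (fun r => V2 r + A (r, X r)) 0 (Icc 0 t) r := by
    intro r hr
    refine ((hc.deriv_V2 r hr).add (hA.hasDerivWithinAt_comp (Icc_subset_Ico_of_lt ht) hr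
      (hc.deriv_X r hr))).congr_deriv ?_
    simp only [K2]
    ring
  have := (convex_Icc 0 t).norm_image_sub_le_of_norm_hasDerivWithin_le
    (C := 0) hd (by simp) hs ⟨hs.1.trans hs.2, le_rfl⟩
  rw [zero_mul, norm_le_zero_iff, sub_eq_zero] at this
  rw [hc.X_end, hc.V2_end] at this
  exact this.symm

lemma sub_eq_integral (hA : IsPotential T E2 B A) (hsol : IsC1Solution T b f E1 E2 B) {t : ℝ}
    (ht : t ∈ Ico 0 T) (p q : ℝ) : A (t, q) - A (t, p) =
      ((∫ y in p..q, travField E2 B 1 t y) - ∫ y in p..q, travField E2 B (-1) t y) / 2 := by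
  have h1 := continuous_field_space hsol.contDiff_E2 ht
  have h2 := continuous_field_space hsol.contDiff_B ht
  rw [← intervalIntegral.integral_eq_sub_of_hasDerivAt (fun y _ => hA.hasDerivAt_space ht y)
    (h2.intervalIntegrable _ _), ← intervalIntegral.integral_sub, ← intervalIntegral.integral_div]
  · refine intervalIntegral.integral_congr fun y _ => ?_
    simp only [travField]
    ring
  · exact (h1.add (continuous_const.mul h2)).intervalIntegrable _ _
  · exact (h1.add (continuous_const.mul h2)).intervalIntegrable _ _

end IsPotential

/-! ### A priori bounds on the support of the density -/

/-- A form of Gronwall's inequality: a bounded ratio `y / w` that improves from `K` to `C + K / 2`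
is at most `2 C`. With `w` an exponential weight in time this replaces a Gronwall argument for the
support functions, whose regularity in time is not known. -/
lemma le_of_forall_le_half {ι : Type*} {y w : ι → ℝ} {C K₀ : ℝ} (hC : 0 ≤ C) (hK₀ : 0 ≤ K₀)
    (h₀ : ∀ i, y i ≤ K₀ * w i)
    (step : ∀ K, 0 ≤ K → (∀ i, y i ≤ K * w i) → ∀ i, y i ≤ (C + K / 2) * w i) (i : ι) :
    y i ≤ 2 * C * w i := by
  have key : ∀ n : ℕ, ∀ i, y i ≤ (2 * C + (K₀ - 2 * C) * (1 / 2) ^ n) * w i := by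
    intro n
    induction n with
    | zero => simpa using h₀
    | succ n ih =>
      intro i
      have hq : (1 / 2 : ℝ) ^ n ≤ 1 := pow_le_one₀ (by norm_num) (by norm_num)
      have hq0 : (0 : ℝ) ≤ (1 / 2) ^ n := by positivity
      refine (step _ (by nlinarith [mul_nonneg hK₀ hq0]) ih i).trans_eq ?_
      rw [pow_succ]
      ring
  have hlim : Filter.Tendsto (fun n : ℕ => (2 * C + (K₀ - 2 * C) * (1 / 2) ^ n) * w i) Filter.atTop
      (nhds ((2 * C + (K₀ - 2 * C) * 0) * w i)) :=
    ((tendsto_const_nhds.add ((tendsto_pow_atTop_nhds_zero_of_lt_one (by norm_num)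
      (by norm_num)).const_mul (K₀ - 2 * C))).mul_const _)
  simpa using ge_of_tendsto' hlim fun n => key n i

lemma hasDerivWithinAt_Ici_of_Icc {E : Type*} [NormedAddCommGroup E] [NormedSpace ℝ E]
    {V : ℝ → E} {V' : E} {a t s : ℝ} (hs : s ∈ Ico a t)
    (h : HasDerivWithinAt V V' (Icc a t) s) : HasDerivWithinAt V V' (Ici s) s :=
  h.mono_of_mem_nhdsWithin (Icc_mem_nhdsGE_of_mem hs)

lemma abs_le_of_abs_deriv_le_exp {V V' : ℝ → ℝ} {t a k l : ℝ} (hl : 0 < l) (hk : 0 ≤ k)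
    (ht : 0 ≤ t) (hV : ∀ s ∈ Icc 0 t, HasDerivWithinAt V (V' s) (Icc 0 t) s)
    (hb : ∀ s ∈ Icc 0 t, |V' s| ≤ a + k * Real.exp (l * s)) :
    |V t| ≤ |V 0| + a * t + k / l * Real.exp (l * t) := by
  have hd : ∀ s, HasDerivAt (fun s => |V 0| + a * s + k / l * Real.exp (l * s))
      (a + k * Real.exp (l * s)) s := fun s => by
    have := (((hasDerivAt_id s).const_mul a).const_add |V 0|).add
      ((((hasDerivAt_id s).const_mul l).exp).const_mul (k / l))
    refine this.congr_deriv ?_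
    simp only [id, mul_one]
    field_simp
  refine image_norm_le_of_norm_deriv_right_le_deriv_boundary' (f := V) (a := 0) (b := t)
    (fun s hs => (hV s hs).continuousWithinAt)
    (fun s hs => hasDerivWithinAt_Ici_of_Icc hs (hV s (Ico_subset_Icc_self hs))) ?_
    (fun s _ => (hd s).continuousAt.continuousWithinAt) (fun s _ => (hd s).hasDerivWithinAt)
    (fun s hs => hb s (Ico_subset_Icc_self hs)) ⟨ht, le_rfl⟩
  have : 0 ≤ k / l * Real.exp (l * 0) := by positivity
  simp only [Real.norm_eq_abs, mul_zero, add_zero] at this ⊢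
  linarith

lemma abs_travField_le (hsol : IsC1Solution T b f E1 E2 B) {R0 F0 : ℝ}
    (hI : HasInitialBounds b f E2 B R0 F0) {σ : ℝ} (hσ : |σ| = 1) {t K l : ℝ} (ht : t ∈ Ico 0 T)
    (hK : 0 ≤ K) (hl : 0 < l) (hj : ∀ s ∈ Icc 0 t, ∀ y, |j2 f s y| ≤ K * Real.exp (l * s))
    (x : ℝ) : |travField E2 B σ t x| ≤ 2 * F0 + K / l * Real.exp (l * t) := by
  have hσ2 : σ ^ 2 = 1 := by rw [← sq_abs, hσ, one_pow]
  rw [travField_eq_ray hsol hσ2 ht]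
  refine (abs_sub _ _).trans (add_le_add ?_ ?_)
  · refine (abs_add_le _ _).trans ?_
    rw [abs_mul, hσ, one_mul, two_mul]
    exact add_le_add (hI.E2_le _) (hI.B_le _)
  · rw [← Real.norm_eq_abs]
    refine (intervalIntegral.norm_integral_le_of_norm_le ht.1
      (.of_forall fun s hs => hj s (Ioc_subset_Icc_self hs) _)
      (Continuous.intervalIntegrable (by fun_prop) _ _)).trans ?_
    exact integral_mul_exp_le hK hl

lemma E2_eq_travField (t x : ℝ) :
    E2 t x = (travField E2 B 1 t x + travField E2 B (-1) t x) / 2 := by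
  simp only [travField]; ring

lemma B_eq_travField (t x : ℝ) :
    B t x = (travField E2 B 1 t x - travField E2 B (-1) t x) / 2 := by
  simp only [travField]; ring

lemma numDensity_le (hsol : IsC1Solution T b f E1 E2 B) {F0 s : ℝ}
    (hs : s ∈ Ico 0 T) (hf : ∀ x v1 v2, f s x v1 v2 ≤ F0) {Y1 Y2 : ℝ} (hY1 : 0 ≤ Y1)
    (hY2 : 0 ≤ Y2) (hY : ∀ x v1 v2, f s x v1 v2 ≠ 0 → |v1| ≤ Y1 ∧ |v2| ≤ Y2) (x : ℝ) :
    numDensity f s x ≤ 4 * Y1 * Y2 * F0 := by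
  set Q : Set (ℝ × ℝ) := Icc (-Y1) Y1 ×ˢ Icc (-Y2) Y2
  have hQ : MeasurableSet Q := measurableSet_Icc.prod measurableSet_Icc
  have hfin : volume Q ≠ ⊤ := (isCompact_Icc.prod isCompact_Icc).measure_lt_top.ne
  calc numDensity f s x ≤ ∫ w, Q.indicator (fun _ => F0) w := by
        refine integral_mono (hsol.integrable_f s hs x)
          ((integrable_indicator_iff hQ).2 (integrableOn_const hfin)) fun w => ?_
        by_cases hw : w ∈ Q
        · simpa [hw] using hf x w.1 w.2
        · rw [indicator_of_notMem hw]
          by_contra hne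
          have := hY x w.1 w.2 (fun h0 => hne h0.le)
          exact hw ⟨abs_le.1 this.1, abs_le.1 this.2⟩
    _ = 4 * Y1 * Y2 * F0 := by
        rw [integral_indicator_const _ hQ, Measure.volume_eq_prod, measureReal_prod_prod,
          Real.volume_real_Icc_of_le (by linarith), Real.volume_real_Icc_of_le (by linarith),
          smul_eq_mul]
        ring

/-- One step of the estimate for `v₂`: conservation of `v₂ + A` reduces it to a bound on the
potential `A`, which is normalised at a point that the fields have not reached. -/
lemma abs_v2_le_step (hsol : IsC1Solution T b f E1 E2 B)
    (hchar : CharacteristicsReachInitialTime T E1 E2 B) {R0 F0 : ℝ}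
    (hI : HasInitialBounds b f E2 B R0 F0) {c : ℝ} (hc : ∀ x, |massPotential b E1 0 x| ≤ c)
    {t1 R : ℝ} (ht1 : t1 < T) (hsupp : SupportedIn f t1 R) {K l : ℝ} (hK : 0 ≤ K) (hl : 0 < l)
    (hY : ∀ s ∈ Icc 0 t1, ∀ x v1 v2, f s x v1 v2 ≠ 0 → |v2| ≤ K * Real.exp (l * s))
    {t : ℝ} (ht : t ∈ Icc 0 t1) {x v1 v2 : ℝ} (hne : f t x v1 v2 ≠ 0) :
    |v2| ≤ R0 + 2 * fieldMass E2 B + 2 * c * K / l * Real.exp (l * t) := by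
  have hf : ∀ t ∈ Ico 0 T, ∀ x v1 v2, 0 ≤ f t x v1 v2 := fun t ht x v1 v2 =>
    (hI.density_mem_Icc hsol hchar ht x v1 v2).1
  have htT : t ∈ Ico 0 T := Icc_subset_Ico_of_lt ht1 ht
  have h0T : (0 : ℝ) ∈ Ico 0 T := ⟨le_rfl, ht.1.trans_lt htT.2⟩
  have hR0 := hI.R0_nonneg
  have hci : ∀ s ∈ Icc 0 t1, ∀ x, |massPotential b E1 s x| ≤ c := fun s hs x =>
    abs_massPotential_le hsol hI.b_cont hf hc ht1 hsupp hs x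
  obtain ⟨A, hA⟩ := exists_isPotential hsol
  obtain ⟨X, V1, V2, hch⟩ := hchar t htT x v1 v2
  have h00 : (0 : ℝ) ∈ Icc 0 t := ⟨le_rfl, ht.1⟩
  have hcons := hA.momentum_conserved htT.2 hch h00
  have hV20 : |V2 0| ≤ R0 := by
    refine (hI.f_supp (X 0) (V1 0) (V2 0) ?_).2.2
    rwa [density_eq_of_isCharacteristic hsol htT.2 hch h00]
  -- a point to the left of both `x` and `X 0`, out of reach of the fields
  set p : ℝ := -(|R| + R0 + T + 1 + |x| + |X 0|) with hp
  have hRabs := abs_nonneg R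
  have hxabs := abs_nonneg x
  have hXabs := abs_nonneg (X 0)
  have hT : 0 < T := h0T.2
  have hpabs : |R| + R0 + T < |p| := by
    rw [hp, abs_neg]
    refine lt_of_lt_of_le ?_ (le_abs_self _)
    linarith
  have hpx : p ≤ x := by linarith [neg_abs_le x]
  have hpX : p ≤ X 0 := by linarith [neg_abs_le (X 0)]
  have hAp : A (t, p) = A (0, p) := by
    have hd : ∀ r ∈ Icc 0 t1, HasDerivWithinAt (fun r => A (r, p)) 0 (Icc 0 t1) r := fun r hr => by
      refine (hA.hasDerivWithinAt_comp (Icc_subset_Ico_of_lt ht1) hr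
        (hasDerivWithinAt_const r _ p)).congr_deriv ?_
      rw [E2_eq_travField (E2 := E2) (B := B),
        travField_eq_zero hsol hI (by norm_num) ht1 hsupp hr hpabs,
        travField_eq_zero hsol hI (by norm_num) ht1 hsupp hr hpabs]
      simp
    have := (convex_Icc 0 t1).norm_image_sub_le_of_norm_hasDerivWithin_le (C := 0) hd (by simp)
      ⟨le_rfl, ht.1.trans ht.2⟩ ht
    rwa [zero_mul, norm_le_zero_iff, sub_eq_zero] at this
  have h1 := hA.sub_eq_integral hsol htT p x
  have h2 := hA.sub_eq_integral hsol h0T p (X 0)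
  have bnd : ∀ σ : ℝ, |σ| = 1 → |∫ y in p..x, travField E2 B σ t y|
      ≤ fieldMass E2 B + 2 * c * K / l * Real.exp (l * t) := fun σ hσ =>
    abs_integral_travField_le hsol hI hf hσ htT
      (fun s hs => hci s ⟨hs.1, hs.2.trans ht.2⟩) hK hl
      (fun s hs => hY s ⟨hs.1, hs.2.trans ht.2⟩) hpx
  have bnd0 : ∀ σ : ℝ, |σ| = 1 → |∫ y in p..X 0, travField E2 B σ 0 y| ≤ fieldMass E2 B :=
    fun σ hσ => abs_integral_travField_zero_le hsol hT hI hσ _ _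
  have a1 := abs_le.1 (bnd 1 (by norm_num))
  have a2 := abs_le.1 (bnd (-1) (by norm_num))
  have a3 := abs_le.1 (bnd0 1 (by norm_num))
  have a4 := abs_le.1 (bnd0 (-1) (by norm_num))
  have a5 := abs_le.1 hV20
  rw [abs_le]
  constructor <;> linarith

/-- One step of the estimate for `v₁`: with `v₂` bounded by `P`, the current `j₂` and hence the
time derivative of `E₂ ± B` along light rays is at most linear in the bound for `v₁`. -/
lemma abs_v1_le_step (hsol : IsC1Solution T b f E1 E2 B)
    (hchar : CharacteristicsReachInitialTime T E1 E2 B) {R0 F0 : ℝ}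
    (hI : HasInitialBounds b f E2 B R0 F0) {t1 cE P : ℝ} (ht1 : t1 < T) (hP : 0 ≤ P)
    (hE1 : ∀ s ∈ Icc 0 t1, ∀ x, |E1 s x| ≤ cE)
    (hY2 : ∀ s ∈ Icc 0 t1, ∀ x v1 v2, f s x v1 v2 ≠ 0 → |v2| ≤ P)
    {K l : ℝ} (hK : 0 ≤ K) (hl : 0 < l)
    (hY : ∀ s ∈ Icc 0 t1, ∀ x v1 v2, f s x v1 v2 ≠ 0 → |v1| ≤ K * Real.exp (l * s))
    {t : ℝ} (ht : t ∈ Icc 0 t1) {x v1 v2 : ℝ} (hne : f t x v1 v2 ≠ 0) :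
    |v1| ≤ R0 + (cE + P * (2 * F0)) * T + 4 * P ^ 3 * F0 * K / l / l * Real.exp (l * t) := by
  have hf := fun t ht x v1 v2 => hI.density_mem_Icc hsol hchar (t := t) ht x v1 v2
  have hF0 := hI.F0_nonneg
  have hsub := Icc_subset_Ico_of_lt ht1
  have htT := hsub ht
  have hcE : 0 ≤ cE := (abs_nonneg _).trans (hE1 t ht 0)
  have hj : ∀ s ∈ Icc 0 t1, ∀ y, |j2 f s y| ≤ 4 * P ^ 2 * F0 * K * Real.exp (l * s) := by
    intro s hs y
    refine (abs_j2_le hsol (fun t ht x v1 v2 => (hf t ht x v1 v2).1) (hsub hs) (hY2 s hs) y).trans ?_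
    have := numDensity_le hsol (hsub hs) (fun x v1 v2 => (hf s (hsub hs) x v1 v2).2)
      (Y1 := K * Real.exp (l * s)) (by positivity) hP
      (fun x v1 v2 h => ⟨hY s hs x v1 v2 h, hY2 s hs x v1 v2 h⟩) y
    calc _ ≤ P * (4 * (K * Real.exp (l * s)) * P * F0) := by gcongr
      _ = _ := by ring
  have hB : ∀ s ∈ Icc 0 t1, ∀ y,
      |B s y| ≤ 2 * F0 + 4 * P ^ 2 * F0 * K / l * Real.exp (l * s) := by
    intro s hs y
    have hG : ∀ σ : ℝ, |σ| = 1 → |travField E2 B σ s y|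
        ≤ 2 * F0 + 4 * P ^ 2 * F0 * K / l * Real.exp (l * s) := fun σ hσ =>
      abs_travField_le hsol hI hσ (hsub hs) (by positivity) hl
        (fun r hr => hj r ⟨hr.1, hr.2.trans hs.2⟩) y
    have a1 := abs_le.1 (hG 1 (by norm_num))
    have a2 := abs_le.1 (hG (-1) (by norm_num))
    rw [B_eq_travField (E2 := E2) (B := B), abs_le]
    constructor <;> linarith
  obtain ⟨X, V1, V2, hch⟩ := hchar t htT x v1 v2
  have hneS : ∀ s ∈ Icc 0 t, f s (X s) (V1 s) (V2 s) ≠ 0 := fun s hs => by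
    rwa [density_eq_of_isCharacteristic hsol htT.2 hch hs]
  have hK1 : ∀ s ∈ Icc 0 t, |K1 E1 B s (X s) (V2 s)|
      ≤ (cE + P * (2 * F0)) + 4 * P ^ 3 * F0 * K / l * Real.exp (l * s) := by
    intro s hs
    have hs1 : s ∈ Icc 0 t1 := ⟨hs.1, hs.2.trans ht.2⟩
    refine (abs_add_le _ _).trans ?_
    rw [abs_mul]
    have h2 := hY2 s hs1 _ _ _ (hneS s hs)
    calc _ ≤ cE + P * (2 * F0 + 4 * P ^ 2 * F0 * K / l * Real.exp (l * s)) :=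
          add_le_add (hE1 s hs1 _) (mul_le_mul h2 (hB s hs1 _) (abs_nonneg _) hP)
      _ = _ := by ring
  have hres := abs_le_of_abs_deriv_le_exp hl (by positivity) ht.1 hch.deriv_V1 hK1
  rw [hch.V1_end] at hres
  have h0 := (hI.f_supp _ _ _ (hneS 0 ⟨le_rfl, ht.1⟩)).2.1
  have h3 : (cE + P * (2 * F0)) * t ≤ (cE + P * (2 * F0)) * T :=
    mul_le_mul_of_nonneg_left htT.2.le (by positivity)
  linarith

/-- A bound for the support of the density that depends on the data and `T` only, as long as the
support is known to be bounded at all. -/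
lemma exists_uniform_support (hsol : IsC1Solution T b f E1 E2 B) (hT : 0 < T)
    (hchar : CharacteristicsReachInitialTime T E1 E2 B) {R0 F0 : ℝ}
    (hI : HasInitialBounds b f E2 B R0 F0) :
    ∃ R, R0 ≤ R ∧ ∀ t1 < T, ∀ R', SupportedIn f t1 R' → SupportedIn f t1 R := by
  have hf : ∀ t ∈ Ico 0 T, ∀ x v1 v2, 0 ≤ f t x v1 v2 := fun t ht x v1 v2 =>
    (hI.density_mem_Icc hsol hchar ht x v1 v2).1
  have hF0 := hI.F0_nonneg
  have hR0 := hI.R0_nonneg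
  have hbi : Integrable b := hI.b_cont.integrable_of_hasCompactSupport hI.b_supp
  obtain ⟨c, hc⟩ := exists_bound_massPotential_zero hsol hT hI
  have hc0 : 0 ≤ c := (abs_nonneg _).trans (hc 0)
  have hfm : 0 ≤ fieldMass E2 B :=
    add_nonneg (integral_nonneg fun _ => abs_nonneg _) (integral_nonneg fun _ => abs_nonneg _)
  have hbn : 0 ≤ ∫ y, |b y| := integral_nonneg fun _ => abs_nonneg _
  set cE := c + ∫ y, |b y| with hcE
  -- the rates make the constants of the two steps at most `1 / 2`
  set l2 : ℝ := 4 * c + 1 with hl2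
  set C2 : ℝ := R0 + 2 * fieldMass E2 B with hC2
  set P2 : ℝ := 2 * C2 * Real.exp (l2 * T) with hP2
  have hP20 : 0 ≤ P2 := by positivity
  set l1 : ℝ := 8 * P2 ^ 3 * F0 + 1 with hl1
  set C1 : ℝ := R0 + (cE + P2 * (2 * F0)) * T with hC1
  have hcE0 : 0 ≤ cE := by positivity
  have hC10 : 0 ≤ C1 := by positivity
  set P1 : ℝ := 2 * C1 * Real.exp (l1 * T) with hP1
  have hP10 : 0 ≤ P1 := by positivity
  have hl2pos : 0 < l2 := by positivity
  have hl1pos : 0 < l1 := by positivity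
  refine ⟨R0 + P1 * T + P1 + P2, by nlinarith [mul_nonneg hP10 hT.le], ?_⟩
  intro t1 ht1 R' hsupp
  have hsub := Icc_subset_Ico_of_lt ht1
  let ι := {p : ℝ × ℝ × ℝ × ℝ // p.1 ∈ Icc 0 t1 ∧ f p.1 p.2.1 p.2.2.1 p.2.2.2 ≠ 0}
  have hexp : ∀ {l s : ℝ}, 0 < l → 0 ≤ s → 1 ≤ Real.exp (l * s) := fun hl hs =>
    Real.one_le_exp (mul_nonneg hl.le hs)
  have hexpT : ∀ {l s C : ℝ}, 0 < l → 0 ≤ C → s ∈ Icc 0 t1 →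
      2 * C * Real.exp (l * s) ≤ 2 * C * Real.exp (l * T) := fun {l s C} hl hC hs => by
    have : s ≤ T := (hsub hs).2.le
    gcongr
  have hv2 : ∀ s ∈ Icc 0 t1, ∀ x v1 v2, f s x v1 v2 ≠ 0 → |v2| ≤ P2 := by
    intro s hs x v1 v2 hne
    refine le_trans ?_ (hexpT (C := C2) hl2pos (by positivity) hs)
    refine le_of_forall_le_half (ι := ι) (y := fun i => |i.1.2.2.2|)
      (w := fun i => Real.exp (l2 * i.1.1)) (C := C2) (K₀ := |R'|) (by positivity) (abs_nonneg _)
      ?_ ?_ ⟨(s, x, v1, v2), hs, hne⟩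
    · rintro ⟨⟨s, x, v1, v2⟩, hs, hne⟩
      have := (hsupp s hs x v1 v2 hne).2.2
      calc |v2| ≤ |R'| * 1 := by linarith [le_abs_self R']
        _ ≤ _ := mul_le_mul_of_nonneg_left (hexp hl2pos hs.1) (abs_nonneg _)
    · rintro K hK hstep ⟨⟨s, x, v1, v2⟩, hs, hne⟩
      have h := abs_v2_le_step hsol hchar hI hc ht1 hsupp hK hl2pos
        (fun s hs x v1 v2 hne => hstep ⟨(s, x, v1, v2), hs, hne⟩) hs hne
      have e1 := hexp hl2pos hs.1
      have e2 : 2 * c * K / l2 ≤ K / 2 := by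
        rw [div_le_iff₀ hl2pos, hl2]
        nlinarith
      have e3 : 2 * c * K / l2 * Real.exp (l2 * s) ≤ K / 2 * Real.exp (l2 * s) := by gcongr
      have e4 : C2 * 1 ≤ C2 * Real.exp (l2 * s) := by gcongr
      simp only
      linarith
  have hE1 : ∀ s ∈ Icc 0 t1, ∀ x, |E1 s x| ≤ cE := fun s hs x =>
    abs_E1_le hbi (abs_massPotential_le hsol hI.b_cont hf hc ht1 hsupp hs x)
  have hv1 : ∀ s ∈ Icc 0 t1, ∀ x v1 v2, f s x v1 v2 ≠ 0 → |v1| ≤ P1 := by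
    intro s hs x v1 v2 hne
    refine le_trans ?_ (hexpT (C := C1) hl1pos (by positivity) hs)
    refine le_of_forall_le_half (ι := ι) (y := fun i => |i.1.2.2.1|)
      (w := fun i => Real.exp (l1 * i.1.1)) (C := C1) (K₀ := |R'|) (by positivity) (abs_nonneg _)
      ?_ ?_ ⟨(s, x, v1, v2), hs, hne⟩
    · rintro ⟨⟨s, x, v1, v2⟩, hs, hne⟩
      have := (hsupp s hs x v1 v2 hne).2.1
      calc |v1| ≤ |R'| * 1 := by linarith [le_abs_self R']
        _ ≤ _ := mul_le_mul_of_nonneg_left (hexp hl1pos hs.1) (abs_nonneg _)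
    · rintro K hK hstep ⟨⟨s, x, v1, v2⟩, hs, hne⟩
      have h := abs_v1_le_step hsol hchar hI ht1 hP20 hE1 hv2 hK hl1pos
        (fun s hs x v1 v2 hne => hstep ⟨(s, x, v1, v2), hs, hne⟩) hs hne
      have e1 := hexp hl1pos hs.1
      have hPF : 0 ≤ P2 ^ 3 * F0 := by positivity
      have e2 : 4 * P2 ^ 3 * F0 * K / l1 / l1 ≤ K / 2 := by
        have e5 : 4 * P2 ^ 3 * F0 * K / l1 ≤ K / 2 := by
          rw [div_le_iff₀ hl1pos, hl1]
          nlinarith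
        refine (div_le_self (by positivity) ?_).trans e5
        rw [hl1]; linarith
      have e3 : 4 * P2 ^ 3 * F0 * K / l1 / l1 * Real.exp (l1 * s)
        ≤ K / 2 * Real.exp (l1 * s) := by gcongr
      have e4 : C1 * 1 ≤ C1 * Real.exp (l1 * s) := by gcongr
      simp only
      linarith
  intro s hs x v1 v2 hne
  have h1 := hv1 s hs x v1 v2 hne
  have h2 := hv2 s hs x v1 v2 hne
  have hPT : 0 ≤ P1 * T := by positivity
  refine ⟨?_, by linarith, by linarith⟩
  obtain ⟨X, V1, V2, hch⟩ := hchar s (hsub hs) x v1 v2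
  have hneS : ∀ r ∈ Icc 0 s, f r (X r) (V1 r) (V2 r) ≠ 0 := fun r hr => by
    rwa [density_eq_of_isCharacteristic hsol (hsub hs).2 hch hr]
  have h00 : (0 : ℝ) ∈ Icc 0 s := ⟨le_rfl, hs.1⟩
  have h3 := (convex_Icc 0 s).norm_image_sub_le_of_norm_hasDerivWithin_le (C := P1) hch.deriv_X
    (fun r hr => hv1 r ⟨hr.1, hr.2.trans hs.2⟩ _ _ _ (hneS r hr)) h00 ⟨hs.1, le_rfl⟩
  have h4 := (hI.f_supp _ _ _ (hneS 0 h00)).1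
  rw [hch.X_end, Real.norm_eq_abs, Real.norm_eq_abs, sub_zero, abs_of_nonneg hs.1] at h3
  have h5 : P1 * s ≤ P1 * T := mul_le_mul_of_nonneg_left (hsub hs).2.le hP10
  have h6 := abs_sub_abs_le_abs_sub x (X 0)
  linarith

/-! ### Uniform bounds up to time `T` -/

lemma exists_bound_field {g : ℝ → ℝ → ℝ}
    (hg : ContDiffOn ℝ 1 (fun p : ℝ × ℝ => g p.1 p.2) (slab T ℝ)) {t1 : ℝ} (ht1 : t1 < T) (R : ℝ) :
    ∃ M : ℝ, 0 ≤ M ∧ ∀ t ∈ Icc 0 t1, ∀ x, |x| ≤ R → |g t x| ≤ M ∧ |deriv (g t) x| ≤ M := by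
  have hKc : IsCompact (Icc 0 t1 ×ˢ Icc (-R) R) := isCompact_Icc.prod isCompact_Icc
  have hKs : Icc 0 t1 ×ˢ Icc (-R) R ⊆ slab T ℝ := fun p hp =>
    ⟨Icc_subset_Ico_of_lt ht1 hp.1, mem_univ _⟩
  obtain ⟨M1, hM1⟩ := hKc.exists_bound_of_continuousOn (hg.continuousOn.mono hKs)
  obtain ⟨M2, hM2⟩ := hKc.exists_bound_of_continuousOn ((continuousOn_field_deriv hg).mono hKs)
  refine ⟨max (max M1 M2) 0, le_max_right _ _, fun t ht x hx => ⟨?_, ?_⟩⟩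
  · exact (hM1 (t, x) ⟨ht, abs_le.1 hx⟩).trans ((le_max_left _ _).trans (le_max_left _ _))
  · exact (hM2 (t, x) ⟨ht, abs_le.1 hx⟩).trans ((le_max_right _ _).trans (le_max_left _ _))

/-- If the density is supported in a cube up to time `t`, then for a short time the support stays
in a slightly larger cube: the part of a characteristic after time `t` starts in the cube, and the
force is bounded near it. -/
lemma SupportedIn.exists_extension (hsol : IsC1Solution T b f E1 E2 B)
    (hchar : CharacteristicsReachInitialTime T E1 E2 B) {t1 R t : ℝ} (ht1 : t1 < T)
    (hR : 0 ≤ R) (ht : 0 ≤ t) (h : SupportedIn f t R) :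
    ∃ δ > 0, ∀ r ∈ Icc t t1, r < t + δ → SupportedIn f r (R + 1) := by
  obtain ⟨M1, hM10, hM1⟩ := exists_bound_field hsol.contDiff_E1 ht1 (R + 1)
  obtain ⟨M2, hM20, hM2⟩ := exists_bound_field hsol.contDiff_E2 ht1 (R + 1)
  obtain ⟨M3, hM30, hM3⟩ := exists_bound_field hsol.contDiff_B ht1 (R + 1)
  set M : ℝ := R + 1 + M1 + M2 + (R + 1) * M3 + 1 with hM
  have hM0 : 0 < M := by positivity
  refine ⟨1 / M, by positivity, ?_⟩
  rintro r ⟨htr, hrt1⟩ hrδ s hs x v1 v2 hne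
  rcases le_total s t with hst | hts
  · obtain ⟨h1, h2, h3⟩ := h s ⟨hs.1, hst⟩ x v1 v2 hne
    exact ⟨by linarith, by linarith, by linarith⟩
  have hsT : s ∈ Ico 0 T := ⟨hs.1, (hs.2.trans hrt1).trans_lt ht1⟩
  obtain ⟨X, V1, V2, hch⟩ := hchar s hsT x v1 v2
  have hneS : f t (X t) (V1 t) (V2 t) ≠ 0 := by
    rwa [density_eq_of_isCharacteristic hsol hsT.2 hch ⟨ht, hts⟩]
  obtain ⟨i1, i2, i3⟩ := h t ⟨ht, le_rfl⟩ _ _ _ hneS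
  set Z : ℝ → ℝ × ℝ × ℝ := fun τ => (X τ, V1 τ, V2 τ) with hZ
  have hsub : Ico t s ⊆ Ico 0 s := fun τ hτ => ⟨ht.trans hτ.1, hτ.2⟩
  have hd : ∀ τ ∈ Icc 0 s, HasDerivWithinAt Z
      (V1 τ, K1 E1 B τ (X τ) (V2 τ), K2 E2 B τ (X τ) (V1 τ)) (Icc 0 s) τ := fun τ hτ =>
    (hch.deriv_X τ hτ).prodMk ((hch.deriv_V1 τ hτ).prodMk (hch.deriv_V2 τ hτ))
  have hle : ∀ τ ∈ Icc t s, M * (τ - t) ≤ 1 := fun τ hτ => by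
    have h1 : τ - t ≤ 1 / M := by linarith [hτ.2, hs.2]
    calc M * (τ - t) ≤ M * (1 / M) := by gcongr
      _ = 1 := by field_simp
  have hbox : ∀ τ ∈ Icc t s, ‖Z τ‖ ≤ R + M * (τ - t) := by
    intro τ hτ
    refine image_norm_le_of_norm_deriv_right_lt_deriv_boundary (f := Z) (a := t) (b := s)
      (B := fun τ => R + M * (τ - t)) (B' := fun _ => M)
      (f' := fun τ => (V1 τ, K1 E1 B τ (X τ) (V2 τ), K2 E2 B τ (X τ) (V1 τ)))
      (fun τ hτ => ((hd τ ⟨ht.trans hτ.1, hτ.2⟩).continuousWithinAt).mono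
        (Icc_subset_Icc_left ht))
      (fun τ hτ => hasDerivWithinAt_Ici_of_Icc (hsub hτ) (hd τ (Ico_subset_Icc_self (hsub hτ))))
      ?_ (fun τ => ?_) ?_ hτ
    · simp [hZ, Prod.norm_def, i1, i2, i3]
    · have := (((hasDerivAt_id τ).sub_const t).const_mul M).const_add R
      exact this.congr_deriv (by simp)
    · intro τ hτ heq
      have hn : ‖Z τ‖ ≤ R + 1 := by
        rw [heq]; linarith [hle τ (Ico_subset_Icc_self hτ)]
      simp only [hZ, Prod.norm_def, sup_le_iff, Real.norm_eq_abs] at hn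
      obtain ⟨n1, n2, n3⟩ := hn
      have hτ1 : τ ∈ Icc 0 t1 := ⟨(hsub hτ).1, hτ.2.le.trans (hs.2.trans hrt1)⟩
      have b1 := (hM1 τ hτ1 _ n1).1
      have b2 := (hM2 τ hτ1 _ n1).1
      have b3 := (hM3 τ hτ1 _ n1).1
      have k1 : |K1 E1 B τ (X τ) (V2 τ)| ≤ M1 + (R + 1) * M3 := by
        refine (abs_add_le _ _).trans (add_le_add b1 ?_)
        rw [abs_mul]
        exact mul_le_mul n3 b3 (abs_nonneg _) (by linarith)
      have k2 : |K2 E2 B τ (X τ) (V1 τ)| ≤ M2 + (R + 1) * M3 := by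
        refine (abs_sub _ _).trans (add_le_add b2 ?_)
        rw [abs_mul]
        exact mul_le_mul n2 b3 (abs_nonneg _) (by linarith)
      have hp : 0 ≤ (R + 1) * M3 := by positivity
      simp only [Prod.norm_def, sup_lt_iff, Real.norm_eq_abs]
      exact ⟨by linarith, by linarith, by linarith⟩
  have hfin := hbox s ⟨hts, le_rfl⟩
  have hfin2 : ‖Z s‖ ≤ R + 1 := by linarith [hle s ⟨hts, le_rfl⟩]
  simp only [hZ, hch.X_end, hch.V1_end, hch.V2_end, Prod.norm_def, sup_le_iff,
    Real.norm_eq_abs] at hfin2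
  exact hfin2

/-- The density stays in a fixed compact set on all of `[0, T)`, by continuous induction in time. -/
lemma exists_supportedIn (hsol : IsC1Solution T b f E1 E2 B) (hT : 0 < T)
    (hchar : CharacteristicsReachInitialTime T E1 E2 B) {R0 F0 : ℝ}
    (hI : HasInitialBounds b f E2 B R0 F0) :
    ∃ R, 0 ≤ R ∧ ∀ t1 < T, SupportedIn f t1 R := by
  obtain ⟨R, hR0, hR⟩ := exists_uniform_support hsol hT hchar hI
  have hRn : 0 ≤ R := hI.R0_nonneg.trans hR0
  refine ⟨R, hRn, fun t1 ht1 => ?_⟩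
  rcases lt_or_ge t1 0 with hneg | h0t1
  · intro s hs
    exact absurd (hs.1.trans hs.2) (not_le.2 hneg)
  set S : Set ℝ := {t | ∀ z : ℝ × ℝ × ℝ, ¬ (|z.1| ≤ R ∧ |z.2.1| ≤ R ∧ |z.2.2| ≤ R) →
    f t z.1 z.2.1 z.2.2 = 0} with hS
  have hsupp : ∀ {t}, Icc 0 t ⊆ S → SupportedIn f t R := fun h s hs x v1 v2 hne => by
    by_contra hout
    exact hne (h hs (x, v1, v2) hout)
  have hclosed : IsClosed (S ∩ Icc 0 t1) := by
    have e : S ∩ Icc 0 t1 = Icc 0 t1 ∩ ⋂ z : ℝ × ℝ × ℝ,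
        ⋂ _ : ¬ (|z.1| ≤ R ∧ |z.2.1| ≤ R ∧ |z.2.2| ≤ R),
          (Icc 0 t1 ∩ (fun t => f t z.1 z.2.1 z.2.2) ⁻¹' {0}) := by
      ext t
      simp only [hS, mem_inter_iff, mem_ofPred_eq, mem_iInter, mem_preimage, mem_singleton_iff]
      exact ⟨fun h => ⟨h.2, fun z hz => ⟨h.2, h.1 z hz⟩⟩, fun h => ⟨fun z hz => (h.2 z hz).2, h.1⟩⟩
    rw [e]
    refine isClosed_Icc.inter (isClosed_iInter fun z => isClosed_iInter fun _ => ?_)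
    refine ContinuousOn.preimage_isClosed_of_isClosed ?_ isClosed_Icc isClosed_singleton
    exact hsol.contDiff_f.continuousOn.comp (f := fun t : ℝ => (t, z)) (by fun_prop)
      fun t ht => ⟨Icc_subset_Ico_of_lt ht1 ht, mem_univ _⟩
  have h0S : (0 : ℝ) ∈ S := fun z hz => by
    by_contra hne
    obtain ⟨h1, h2, h3⟩ := hI.f_supp _ _ _ hne
    exact hz ⟨h1.trans hR0, h2.trans hR0, h3.trans hR0⟩
  refine hsupp (hclosed.Icc_subset_of_forall_mem_nhdsGT_of_Icc_subset h0S ?_)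
  intro t ht hsubS
  obtain ⟨δ, hδ, hext⟩ := (hsupp hsubS).exists_extension hsol hchar ht1 hRn ht.1
  have hmem : Ioo t (min t1 (t + δ)) ∈ nhdsWithin t (Ioi t) :=
    Ioo_mem_nhdsGT (lt_min ht.2 (by linarith))
  filter_upwards [hmem] with r hr z hz
  have hr1 : r < t1 := hr.2.trans_le (min_le_left _ _)
  have hr2 : r < t + δ := hr.2.trans_le (min_le_right _ _)
  by_contra hne
  exact hz (hR r (hr1.trans ht1) _ (hext r ⟨hr.1.le, hr1.le⟩ hr2) r
    ⟨ht.1.trans hr.1.le, le_rfl⟩ _ _ _ hne)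

/-- Bounds for the solution that hold uniformly on `[0, T)`. -/
structure HasUniformBounds (T : ℝ) (f : ℝ → ℝ → ℝ → ℝ → ℝ) (E1 E2 B : ℝ → ℝ → ℝ)
    (R M : ℝ) : Prop where
  R_nonneg : 0 ≤ R
  M_nonneg : 0 ≤ M
  supp : ∀ t ∈ Ico 0 T, ∀ x v1 v2, f t x v1 v2 ≠ 0 → |x| ≤ R ∧ |v1| ≤ R ∧ |v2| ≤ R
  E1_le : ∀ t ∈ Ico 0 T, ∀ x, |E1 t x| ≤ M
  trav_le : ∀ t ∈ Ico 0 T, ∀ σ, |σ| = 1 → ∀ x, |travField E2 B σ t x| ≤ M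
  deriv_E1_le : ∀ t ∈ Ico 0 T, ∀ x, |deriv (E1 t) x| ≤ M
  j2_le : ∀ t ∈ Ico 0 T, ∀ x, |j2 f t x| ≤ M

namespace HasUniformBounds

variable {R M : ℝ}

lemma E2_le (h : HasUniformBounds T f E1 E2 B R M) {t : ℝ} (ht : t ∈ Ico 0 T) (x : ℝ) :
    |E2 t x| ≤ M := by
  have a1 := abs_le.1 (h.trav_le t ht 1 (by norm_num) x)
  have a2 := abs_le.1 (h.trav_le t ht (-1) (by norm_num) x)
  rw [E2_eq_travField (E2 := E2) (B := B), abs_le]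
  constructor <;> linarith

lemma B_le (h : HasUniformBounds T f E1 E2 B R M) {t : ℝ} (ht : t ∈ Ico 0 T) (x : ℝ) :
    |B t x| ≤ M := by
  have a1 := abs_le.1 (h.trav_le t ht 1 (by norm_num) x)
  have a2 := abs_le.1 (h.trav_le t ht (-1) (by norm_num) x)
  rw [B_eq_travField (E2 := E2) (B := B), abs_le]
  constructor <;> linarith

lemma K1_le (h : HasUniformBounds T f E1 E2 B R M) {t : ℝ} (ht : t ∈ Ico 0 T) (x : ℝ) {v2 : ℝ}
    (hv : |v2| ≤ R) : |K1 E1 B t x v2| ≤ M + R * M := by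
  refine (abs_add_le _ _).trans (add_le_add (h.E1_le t ht x) ?_)
  rw [abs_mul]
  exact mul_le_mul hv (h.B_le ht x) (abs_nonneg _) h.R_nonneg

lemma K2_le (h : HasUniformBounds T f E1 E2 B R M) {t : ℝ} (ht : t ∈ Ico 0 T) (x : ℝ) {v1 : ℝ}
    (hv : |v1| ≤ R) : |K2 E2 B t x v1| ≤ M + R * M := by
  refine (abs_sub _ _).trans (add_le_add (h.E2_le ht x) ?_)
  rw [abs_mul]
  exact mul_le_mul hv (h.B_le ht x) (abs_nonneg _) h.R_nonneg

end HasUniformBounds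

lemma exists_uniformBounds (hsol : IsC1Solution T b f E1 E2 B) (hT : 0 < T)
    (hchar : CharacteristicsReachInitialTime T E1 E2 B) {R0 F0 : ℝ}
    (hI : HasInitialBounds b f E2 B R0 F0) :
    ∃ R M, HasUniformBounds T f E1 E2 B R M := by
  obtain ⟨R, hR0, hR⟩ := exists_supportedIn hsol hT hchar hI
  have hf := fun t ht x v1 v2 => hI.density_mem_Icc hsol hchar (t := t) ht x v1 v2
  have hf0 : ∀ t ∈ Ico 0 T, ∀ x v1 v2, 0 ≤ f t x v1 v2 := fun t ht x v1 v2 => (hf t ht x v1 v2).1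
  have hF0 := hI.F0_nonneg
  have hbi : Integrable b := hI.b_cont.integrable_of_hasCompactSupport hI.b_supp
  obtain ⟨c, hc⟩ := exists_bound_massPotential_zero hsol hT hI
  obtain ⟨β, hβ⟩ := hI.b_supp.exists_bound_of_continuous hI.b_cont
  have hc0 : 0 ≤ c := (abs_nonneg _).trans (hc 0)
  have hβ0 : 0 ≤ β := (norm_nonneg _).trans (hβ 0)
  have hbn : 0 ≤ ∫ y, |b y| := integral_nonneg fun _ => abs_nonneg _
  have hsupp : ∀ t ∈ Ico 0 T, ∀ x v1 v2, f t x v1 v2 ≠ 0 → |x| ≤ R ∧ |v1| ≤ R ∧ |v2| ≤ R :=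
    fun t ht => hR t ht.2 t ⟨ht.1, le_rfl⟩
  have hn : ∀ t ∈ Ico 0 T, ∀ x, numDensity f t x ≤ 4 * R * R * F0 := fun t ht x =>
    numDensity_le hsol ht (fun x v1 v2 => (hf t ht x v1 v2).2) hR0 hR0
      (fun x v1 v2 h => (hsupp t ht x v1 v2 h).2) x
  have hj : ∀ t ∈ Ico 0 T, ∀ x, |j2 f t x| ≤ R * (4 * R * R * F0) := fun t ht x =>
    (abs_j2_le hsol hf0 ht (fun x v1 v2 h => (hsupp t ht x v1 v2 h).2.2) x).trans
      (mul_le_mul_of_nonneg_left (hn t ht x) hR0)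
  set J : ℝ := R * (4 * R * R * F0) with hJ
  have hJ0 : 0 ≤ J := by positivity
  set m1 := c + ∫ y, |b y| with hm1
  set m2 := 2 * F0 + J / 1 * Real.exp (1 * T) with hm2
  set m3 := 4 * R * R * F0 + β with hm3
  have h1 : 0 ≤ m1 := by positivity
  have h2 : 0 ≤ m2 := by positivity
  have h3 : 0 ≤ m3 := by positivity
  refine ⟨R, m1 + m2 + m3 + J, hR0, by positivity, hsupp, fun t ht x => ?_,
    fun t ht σ hσ x => ?_, fun t ht x => ?_, fun t ht x => ?_⟩
  · have := abs_E1_le hbi (abs_massPotential_le hsol hI.b_cont hf0 hc ht.2 (hR t ht.2)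
      ⟨ht.1, le_rfl⟩ x)
    linarith
  · have h5 := abs_travField_le hsol hI hσ ht hJ0 one_pos (fun s hs y => by
      refine (hj s ⟨hs.1, hs.2.trans_lt ht.2⟩ y).trans (le_mul_of_one_le_right hJ0 ?_)
      exact Real.one_le_exp (by linarith [hs.1])) x
    have h6 : J / 1 * Real.exp (1 * t) ≤ J / 1 * Real.exp (1 * T) := by
      have := ht.2.le
      gcongr
    linarith
  · rw [show deriv (E1 t) x = numDensity f t x - b x from hsol.gauss t ht x]
    have h5 : |numDensity f t x| ≤ 4 * R * R * F0 := by
      have h0 : 0 ≤ numDensity f t x := integral_nonneg fun w => hf0 t ht _ _ _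
      rw [abs_of_nonneg h0]
      exact hn t ht x
    have h6 := (abs_sub (numDensity f t x) (b x)).trans (add_le_add h5 (hβ x))
    linarith
  · have := hj t ht x
    linarith

/-! ### Comparison of neighbouring characteristics -/

/-- Gronwall's inequality for a pair of functions, backward in time from `t` to `a`. -/
lemma abs_le_of_backward_gronwall {ξ u ξ' u' : ℝ → ℝ} {a t T C d : ℝ} (hC : 0 ≤ C) (hd : 0 ≤ d)
    (hT : t - a ≤ T)
    (hξ : ∀ s ∈ Icc a t, HasDerivWithinAt ξ (ξ' s) (Icc a t) s)
    (hu : ∀ s ∈ Icc a t, HasDerivWithinAt u (u' s) (Icc a t) s)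
    (bξ : ∀ s ∈ Icc a t, |ξ' s| ≤ C * (|ξ s| + |u s| + d))
    (bu : ∀ s ∈ Icc a t, |u' s| ≤ C * (|ξ s| + |u s| + d))
    (tξ : |ξ t| ≤ C * d) (tu : |u t| ≤ C * d) {s : ℝ} (hs : s ∈ Icc a t) :
    |ξ s| ≤ 2 * C * Real.exp ((2 * C + 1) * T) * d ∧
      |u s| ≤ 2 * C * Real.exp ((2 * C + 1) * T) * d := by
  set F : ℝ → ℝ × ℝ := fun σ => (ξ (t - σ), u (t - σ)) with hF
  have hmem : ∀ σ ∈ Icc 0 (t - a), t - σ ∈ Icc a t := fun σ hσ =>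
    ⟨by linarith [hσ.2], by linarith [hσ.1]⟩
  have hder : ∀ σ ∈ Icc 0 (t - a), HasDerivWithinAt F (-ξ' (t - σ), -u' (t - σ))
      (Icc 0 (t - a)) σ := fun σ hσ => by
    have hin : HasDerivWithinAt (fun σ => t - σ) (-1) (Icc 0 (t - a)) σ :=
      (hasDerivWithinAt_id σ _).const_sub t
    have h1 := (hξ _ (hmem σ hσ)).comp σ hin hmem
    have h2 := (hu _ (hmem σ hσ)).comp σ hin hmem
    exact (h1.prodMk h2).congr_deriv (by simp)
  have hCd : 0 ≤ C * d := by positivity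
  have key := norm_le_gronwallBound_of_norm_deriv_right_le (f := F) (δ := C * d) (K := 2 * C + 1)
    (ε := C * d) (a := 0) (b := t - a) (f' := fun σ => (-ξ' (t - σ), -u' (t - σ)))
    (fun σ hσ => (hder σ hσ).continuousWithinAt)
    (fun σ hσ => hasDerivWithinAt_Ici_of_Icc hσ (hder σ (Ico_subset_Icc_self hσ)))
    (by simp [hF, Prod.norm_def, tξ, tu])
    (fun σ hσ => by
      have hm := hmem σ (Ico_subset_Icc_self hσ)
      have n1 : |ξ (t - σ)| ≤ ‖F σ‖ := norm_fst_le (F σ)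
      have n2 : |u (t - σ)| ≤ ‖F σ‖ := norm_snd_le (F σ)
      have h3 : C * (|ξ (t - σ)| + |u (t - σ)| + d) ≤ (2 * C + 1) * ‖F σ‖ + C * d := by
        nlinarith [norm_nonneg (F σ)]
      simp only [Prod.norm_def, norm_neg, Real.norm_eq_abs (ξ' _), Real.norm_eq_abs (u' _)]
      exact max_le ((bξ _ hm).trans h3) ((bu _ hm).trans h3))
    (t - s) ⟨by linarith [hs.2], by linarith [hs.1]⟩
  have hK : (0 : ℝ) < 2 * C + 1 := by positivity
  have hbound : gronwallBound (C * d) (2 * C + 1) (C * d) (t - s - 0)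
      ≤ 2 * C * Real.exp ((2 * C + 1) * T) * d := by
    rw [gronwallBound_of_K_ne_0 hK.ne', sub_zero]
    have he : Real.exp ((2 * C + 1) * (t - s)) ≤ Real.exp ((2 * C + 1) * T) := by
      have : t - s ≤ T := by linarith [hs.1]
      gcongr
    have h1 : C * d / (2 * C + 1) ≤ C * d := div_le_self hCd (by linarith)
    have h0 : 0 ≤ Real.exp ((2 * C + 1) * (t - s)) - 1 := by
      have := Real.one_le_exp (mul_nonneg hK.le (sub_nonneg.2 hs.2))
      linarith
    calc C * d * Real.exp ((2 * C + 1) * (t - s))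
          + C * d / (2 * C + 1) * (Real.exp ((2 * C + 1) * (t - s)) - 1)
        ≤ C * d * Real.exp ((2 * C + 1) * T)
          + C * d * (Real.exp ((2 * C + 1) * (t - s)) - 1) := by
          exact add_le_add (mul_le_mul_of_nonneg_left he hCd)
            (mul_le_mul_of_nonneg_right h1 h0)
      _ ≤ C * d * Real.exp ((2 * C + 1) * T) + C * d * Real.exp ((2 * C + 1) * T) := by
          refine add_le_add le_rfl (mul_le_mul_of_nonneg_left ?_ hCd)
          linarith
      _ = _ := by ring
  have hfin := key.trans hbound
  simp only [hF, sub_sub_cancel, Prod.norm_def, sup_le_iff, Real.norm_eq_abs] at hfin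
  exact hfin

lemma abs_sub_le_of_deriv_le {g : ℝ → ℝ} {g' : ℝ → ℝ} {S : Set ℝ} (hS : Convex ℝ S) {M : ℝ}
    (hg : ∀ x, HasDerivAt g (g' x) x) (hM : ∀ x ∈ S, |g' x| ≤ M) {x y : ℝ} (hx : x ∈ S)
    (hy : y ∈ S) : |g y - g x| ≤ M * |y - x| :=
  hS.norm_image_sub_le_of_norm_hasDerivWithin_le (fun z _ => (hg z).hasDerivWithinAt) hM hx hy

/-- First-order Taylor expansion of a `C¹` field, uniformly on compact sets. -/
lemma exists_uniform_taylor {g : ℝ → ℝ → ℝ}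
    (hg : ContDiffOn ℝ 1 (fun p : ℝ × ℝ => g p.1 p.2) (slab T ℝ)) {t : ℝ} (ht : t < T) (R : ℝ) :
    ∃ r > 0, ∀ s ∈ Icc 0 t, ∀ x y, |x| ≤ R → |y| ≤ R → |y - x| < r →
      |g s y - g s x - deriv (g s) x * (y - x)| ≤ |y - x| := by
  have hKc : IsCompact (Icc 0 t ×ˢ Icc (-R) R) := isCompact_Icc.prod isCompact_Icc
  have huc := hKc.uniformContinuousOn_of_continuous ((continuousOn_field_deriv hg).mono
    fun p hp => ⟨Icc_subset_Ico_of_lt ht hp.1, mem_univ _⟩)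
  obtain ⟨r, hr, h⟩ := Metric.uniformContinuousOn_iff.1 huc 1 one_pos
  refine ⟨r, hr, fun s hs x y hx hy hxy => ?_⟩
  have hsub : uIcc x y ⊆ Icc (-R) R := uIcc_subset_Icc (abs_le.1 hx) (abs_le.1 hy)
  have hder : ∀ z, HasDerivAt (fun z => g s z - deriv (g s) x * z)
      (deriv (g s) z - deriv (g s) x) z := fun z =>
    ((hasDerivAt_field_space hg (Icc_subset_Ico_of_lt ht hs) z).sub
      ((hasDerivAt_id z).const_mul _)).congr_deriv (by simp)
  have := abs_sub_le_of_deriv_le (convex_uIcc x y) hder (M := 1) (fun z hz => by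
      have hzx : |z - x| < r := (abs_sub_left_of_mem_uIcc hz).trans_lt hxy
      have := h (s, z) ⟨hs, hsub hz⟩ (s, x) ⟨hs, abs_le.1 hx⟩ (by
        rw [Prod.dist_eq, dist_self, Real.dist_eq]
        exact max_lt hr hzx)
      rw [Real.dist_eq] at this
      exact this.le) left_mem_uIcc right_mem_uIcc
  rw [one_mul] at this
  refine le_of_eq_of_le ?_ this
  congr 1
  ring

/-- A characteristic whose phase-space positions stay in the cube of half-width `R`. -/
structure IsBoundedCharacteristic (E1 E2 B : ℝ → ℝ → ℝ) (R t x v1 v2 : ℝ) (X V1 V2 : ℝ → ℝ) :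
    Prop extends IsCharacteristic E1 E2 B t x v1 v2 X V1 V2 where
  bound : ∀ s ∈ Icc 0 t, |X s| ≤ R ∧ |V1 s| ≤ R ∧ |V2 s| ≤ R

lemma HasUniformBounds.exists_characteristic (hsol : IsC1Solution T b f E1 E2 B)
    (hchar : CharacteristicsReachInitialTime T E1 E2 B) {R M : ℝ}
    (hU : HasUniformBounds T f E1 E2 B R M) {t : ℝ} (ht : t ∈ Ico 0 T) {x v1 v2 : ℝ}
    (hne : f t x v1 v2 ≠ 0) :
    ∃ X V1 V2, IsBoundedCharacteristic E1 E2 B R t x v1 v2 X V1 V2 := by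
  obtain ⟨X, V1, V2, hch⟩ := hchar t ht x v1 v2
  refine ⟨X, V1, V2, hch, fun s hs => hU.supp s (Icc_subset_Ico_of_lt ht.2 hs) _ _ _ ?_⟩
  rwa [density_eq_of_isCharacteristic hsol ht.2 hch hs]

section Comparison

variable {R M t x v1 v2 y w1 w2 d : ℝ} {X V1 V2 Y W1 W2 : ℝ → ℝ}

/-- The difference of the `v₂`-components is controlled by that of the positions, by conservation
of `v₂ + A`. -/
lemma abs_sub_V2_le (hsol : IsC1Solution T b f E1 E2 B) (hU : HasUniformBounds T f E1 E2 B R M)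
    (ht : t ∈ Ico 0 T) (hX : IsCharacteristic E1 E2 B t x v1 v2 X V1 V2)
    (hY : IsCharacteristic E1 E2 B t y w1 w2 Y W1 W2) (hx : |y - x| ≤ d) (h2 : |w2 - v2| ≤ d)
    {s : ℝ} (hs : s ∈ Icc 0 t) : |W2 s - V2 s| ≤ d + M * (|Y s - X s| + d) := by
  obtain ⟨A, hA⟩ := exists_isPotential hsol
  have e1 := hA.momentum_conserved ht.2 hX hs
  have e2 := hA.momentum_conserved ht.2 hY hs
  have lip : ∀ r ∈ Ico 0 T, ∀ p q, |A (r, q) - A (r, p)| ≤ M * |q - p| := fun r hr p q =>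
    abs_sub_le_of_deriv_le convex_univ (hA.hasDerivAt_space hr) (fun z _ => hU.B_le hr z)
      (mem_univ p) (mem_univ q)
  have l1 := abs_le.1 (lip t ht x y)
  have l2 := abs_le.1 (lip s (Icc_subset_Ico_of_lt ht.2 hs) (X s) (Y s))
  have l3 : M * |y - x| ≤ M * d := mul_le_mul_of_nonneg_left hx hU.M_nonneg
  have l4 := abs_le.1 h2
  rw [abs_le]
  constructor <;> linarith

/-- The difference of the forces `K₁` at two phase-space points. -/
lemma K1_sub_K1 (s p q a c : ℝ) : K1 E1 B s q c - K1 E1 B s p a =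
    (E1 s q - E1 s p) + (c - a) * B s q + a * (B s q - B s p) := by
  simp only [K1]; ring

lemma hasDerivWithinAt_sub_X (hX : IsCharacteristic E1 E2 B t x v1 v2 X V1 V2)
    (hY : IsCharacteristic E1 E2 B t y w1 w2 Y W1 W2) {a s : ℝ} (ha : 0 ≤ a) (hs : s ∈ Icc a t) :
    HasDerivWithinAt (fun r => Y r - X r) (W1 s - V1 s) (Icc a t) s :=
  (((hY.deriv_X s ⟨ha.trans hs.1, hs.2⟩).sub (hX.deriv_X s ⟨ha.trans hs.1, hs.2⟩))).mono
    (Icc_subset_Icc_left ha)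

lemma hasDerivWithinAt_sub_V1 (hX : IsCharacteristic E1 E2 B t x v1 v2 X V1 V2)
    (hY : IsCharacteristic E1 E2 B t y w1 w2 Y W1 W2) {a s : ℝ} (ha : 0 ≤ a) (hs : s ∈ Icc a t) :
    HasDerivWithinAt (fun r => W1 r - V1 r)
      (K1 E1 B s (Y s) (W2 s) - K1 E1 B s (X s) (V2 s)) (Icc a t) s :=
  (((hY.deriv_V1 s ⟨ha.trans hs.1, hs.2⟩).sub (hX.deriv_V1 s ⟨ha.trans hs.1, hs.2⟩))).mono
    (Icc_subset_Icc_left ha)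

/-- The part of the difference of the forces that does not involve derivatives of `B`. -/
lemma abs_force_sub_le (hsol : IsC1Solution T b f E1 E2 B)
    (hU : HasUniformBounds T f E1 E2 B R M)
    (ht : t ∈ Ico 0 T) (hX : IsCharacteristic E1 E2 B t x v1 v2 X V1 V2)
    (hY : IsCharacteristic E1 E2 B t y w1 w2 Y W1 W2) (hx : |y - x| ≤ d) (h2 : |w2 - v2| ≤ d)
    {s : ℝ} (hs : s ∈ Icc 0 t) :
    |(E1 s (Y s) - E1 s (X s)) + (W2 s - V2 s) * B s (Y s)|
      ≤ (M + M ^ 2) * (|Y s - X s| + d) := by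
  have hsT := Icc_subset_Ico_of_lt ht.2 hs
  have hM := hU.M_nonneg
  have i1 : |E1 s (Y s) - E1 s (X s)| ≤ M * |Y s - X s| :=
    abs_sub_le_of_deriv_le convex_univ (hasDerivAt_field_space hsol.contDiff_E1 hsT)
      (fun z _ => hU.deriv_E1_le s hsT z) (mem_univ _) (mem_univ _)
  have i2 := abs_sub_V2_le hsol hU ht hX hY hx h2 hs
  have i3 : |(W2 s - V2 s) * B s (Y s)| ≤ (d + M * (|Y s - X s| + d)) * M := by
    rw [abs_mul]
    exact mul_le_mul i2 (hU.B_le hsT _) (abs_nonneg _) ((abs_nonneg _).trans i2)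
  refine (abs_add_le _ _).trans ((add_le_add i1 i3).trans_eq ?_)
  ring

/-- Lipschitz dependence of characteristics on their end point, with a constant that may blow up
as `t → T`. -/
lemma exists_lipschitz_characteristics (hsol : IsC1Solution T b f E1 E2 B)
    (hU : HasUniformBounds T f E1 E2 B R M) (ht : t ∈ Ico 0 T) :
    ∃ Γ, 0 ≤ Γ ∧ ∀ {x v1 v2 y w1 w2 d : ℝ} {X V1 V2 Y W1 W2 : ℝ → ℝ},
      IsBoundedCharacteristic E1 E2 B R t x v1 v2 X V1 V2 →
      IsBoundedCharacteristic E1 E2 B R t y w1 w2 Y W1 W2 →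
      |y - x| ≤ d → |w1 - v1| ≤ d → |w2 - v2| ≤ d → ∀ s ∈ Icc 0 t, |Y s - X s| ≤ Γ * d := by
  obtain ⟨Λ, hΛ0, hΛ⟩ := exists_bound_field hsol.contDiff_B ht.2 R
  have hM := hU.M_nonneg
  have hR := hU.R_nonneg
  set C : ℝ := 1 + (M + M ^ 2) + R * Λ with hC
  have hC0 : 0 ≤ C := by positivity
  have hC1 : 1 ≤ C := by
    have : 0 ≤ M + M ^ 2 + R * Λ := by positivity
    linarith
  refine ⟨2 * C * Real.exp ((2 * C + 1) * T), by positivity, ?_⟩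
  intro x v1 v2 y w1 w2 d X V1 V2 Y W1 W2 hX hY hx h1 h2 s hs
  have hd : 0 ≤ d := (abs_nonneg _).trans hx
  refine (abs_le_of_backward_gronwall hC0 hd (by linarith [ht.2])
    (fun s hs => hasDerivWithinAt_sub_X hX.1 hY.1 le_rfl hs)
    (fun s hs => hasDerivWithinAt_sub_V1 hX.1 hY.1 le_rfl hs)
    (fun r hr => ?_) (fun r hr => ?_) ?_ ?_ hs).1
  · have hp := abs_nonneg (Y r - X r)
    have hp1 := abs_nonneg (W1 r - V1 r)
    calc |W1 r - V1 r| ≤ 1 * (|Y r - X r| + |W1 r - V1 r| + d) := by linarith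
      _ ≤ _ := by gcongr
  · have hp1 := abs_nonneg (W1 r - V1 r)
    have hp := abs_nonneg (Y r - X r)
    have hrT := Icc_subset_Ico_of_lt ht.2 hr
    rw [K1_sub_K1]
    have i1 := abs_force_sub_le hsol hU ht hX.1 hY.1 hx h2 hr
    have i2 : |B r (Y r) - B r (X r)| ≤ Λ * |Y r - X r| :=
      abs_sub_le_of_deriv_le (convex_Icc (-R) R) (hasDerivAt_field_space hsol.contDiff_B hrT)
        (fun z hz => (hΛ r hr z (abs_le.2 hz)).2) (abs_le.1 (hX.bound r hr).1)
        (abs_le.1 (hY.bound r hr).1)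
    have i3 : |V2 r * (B r (Y r) - B r (X r))| ≤ R * (Λ * |Y r - X r|) := by
      rw [abs_mul]
      exact mul_le_mul (hX.bound r hr).2.2 i2 (abs_nonneg _) hR
    refine (abs_add_le _ _).trans ((add_le_add i1 i3).trans ?_)
    set S := |Y r - X r| + |W1 r - V1 r| + d with hS
    calc _ ≤ (M + M ^ 2) * S + R * (Λ * S) := by
          gcongr <;> linarith
      _ = (M + M ^ 2 + R * Λ) * S := by ring
      _ ≤ C * S := by gcongr; linarith
  · simp only [hX.X_end, hY.X_end]
    nlinarith
  · simp only [hX.V1_end, hY.V1_end]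
    nlinarith

/-- Along a characteristic that stays away from the light speed `σ`, the spatial derivative of the
travelling component `E₂ + σ B` is, up to a bounded error, the time derivative of a bounded
quantity. -/
lemma exists_hasDerivWithinAt_travField_div (hsol : IsC1Solution T b f E1 E2 B)
    (hU : HasUniformBounds T f E1 E2 B R M) (ht : t ∈ Ico 0 T)
    (hX : IsBoundedCharacteristic E1 E2 B R t x v1 v2 X V1 V2) {σ η a s : ℝ} (hσ : |σ| = 1)
    (hη : 0 < η) (ha : 0 ≤ a) (hs : s ∈ Icc a t) (hV : η ≤ |V1 s - σ|) :
    |travField E2 B σ s (X s) / (V1 s - σ)| ≤ M / η ∧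
    ∃ e, |e| ≤ M / η + M * (M + R * M) / η ^ 2 ∧
      HasDerivWithinAt (fun r => travField E2 B σ r (X r) / (V1 r - σ))
        (deriv (E2 s) (X s) + σ * deriv (B s) (X s) + e) (Icc a t) s := by
  have hσ2 : σ ^ 2 = 1 := by rw [← sq_abs, hσ, one_pow]
  have hs0 : s ∈ Icc 0 t := ⟨ha.trans hs.1, hs.2⟩
  have hsT := Icc_subset_Ico_of_lt ht.2 hs0
  have hM := hU.M_nonneg
  have hR := hU.R_nonneg
  have hne : V1 s - σ ≠ 0 := abs_pos.1 (hη.trans_le hV)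
  refine ⟨?_, -j2 f s (X s) / (V1 s - σ)
    - travField E2 B σ s (X s) * K1 E1 B s (X s) (V2 s) / (V1 s - σ) ^ 2, ?_, ?_⟩
  · rw [abs_div]
    exact div_le_div₀ hM (hU.trav_le s hsT σ hσ _) hη hV
  · refine (abs_sub _ _).trans (add_le_add ?_ ?_)
    · rw [abs_div, abs_neg]
      exact div_le_div₀ hM (hU.j2_le s hsT _) hη hV
    · rw [abs_div, abs_mul, abs_pow]
      refine div_le_div₀ (by positivity) ?_ (by positivity) (by gcongr)
      exact mul_le_mul (hU.trav_le s hsT σ hσ _) (hU.K1_le hsT _ (hX.bound s hs0).2.2)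
        (abs_nonneg _) hM
  · have h1 := hasDerivWithinAt_travField_comp hsol hσ2 (Icc_subset_Ico_of_lt ht.2) hs0
      (hX.deriv_X s hs0)
    have h2 := h1.fun_div ((hX.deriv_V1 s hs0).sub_const σ) hne
    refine (h2.mono (Icc_subset_Icc_left ha)).congr_deriv ?_
    field_simp
    ring

/-- Lipschitz dependence on the end point of characteristics whose velocity `v₁` stays at distance
`η` from `±1`, with a constant `Γ` independent of `t < T`. The derivative of `B` in the
linearised force is removed by subtracting from `ΔV₁` the bounded multiple
`V₂ ((E₂ + B) / (V₁ - 1) - (E₂ - B) / (V₁ + 1)) / 2` of `ΔX`. -/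
lemma exists_uniform_lipschitz_characteristics (hsol : IsC1Solution T b f E1 E2 B)
    (hU : HasUniformBounds T f E1 E2 B R M) {η : ℝ} (hη : 0 < η) :
    ∃ Γ, 0 ≤ Γ ∧ ∀ {t a x v1 v2 y w1 w2 d : ℝ} {X V1 V2 Y W1 W2 : ℝ → ℝ},
      t ∈ Ico 0 T → 0 ≤ a → a ≤ t →
      IsBoundedCharacteristic E1 E2 B R t x v1 v2 X V1 V2 →
      IsBoundedCharacteristic E1 E2 B R t y w1 w2 Y W1 W2 →
      (∀ s ∈ Icc a t, ∀ σ, |σ| = 1 → η ≤ |V1 s - σ|) →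
      (∀ s ∈ Icc a t, |B s (Y s) - B s (X s) - deriv (B s) (X s) * (Y s - X s)|
        ≤ |Y s - X s|) →
      |y - x| ≤ d → |w1 - v1| ≤ d → |w2 - v2| ≤ d →
      |Y a - X a| ≤ Γ * d ∧ |W1 a - V1 a| ≤ Γ * d ∧ |W2 a - V2 a| ≤ Γ * d := by
  have hM := hU.M_nonneg
  have hR := hU.R_nonneg
  set m : ℝ := M / η with hm
  set κ : ℝ := M + R * M with hκ
  set e₀ : ℝ := M / η + M * κ / η ^ 2 with he₀
  have hm0 : 0 ≤ m := by positivity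
  have hκ0 : 0 ≤ κ := by positivity
  have he00 : 0 ≤ e₀ := by positivity
  set C : ℝ := 1 + R * m + ((M + M ^ 2) + R + κ * m + R * m * (1 + R * m) + R * e₀) with hC
  have hCa : 1 + R * m ≤ C := by
    have : 0 ≤ (M + M ^ 2) + R + κ * m + R * m * (1 + R * m) + R * e₀ := by positivity
    linarith
  have hCb : (M + M ^ 2) + R + κ * m + R * m * (1 + R * m) + R * e₀ ≤ C := by
    have : 0 ≤ 1 + R * m := by positivity
    linarith
  have hC1 : 1 ≤ C := by
    have : 0 ≤ R * m := by positivity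
    linarith
  have hC0 : 0 ≤ C := by linarith
  set G : ℝ := 2 * C * Real.exp ((2 * C + 1) * T) with hG
  have hG0 : 0 ≤ G := by positivity
  clear_value C
  refine ⟨G + (1 + R * m) * G + (1 + M * (G + 1)), by positivity, ?_⟩
  intro t a x v1 v2 y w1 w2 d X V1 V2 Y W1 W2 ht ha hat hX hY hV hB hx h1 h2
  have hd : 0 ≤ d := (abs_nonneg _).trans hx
  have hsub : Icc a t ⊆ Icc 0 t := Icc_subset_Icc_left ha
  have hp := fun s hs => exists_hasDerivWithinAt_travField_div hsol hU ht hX (σ := 1)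
    (s := s) (by norm_num) hη ha hs (hV s hs 1 (by norm_num))
  have hq := fun s hs => exists_hasDerivWithinAt_travField_div hsol hU ht hX (σ := -1)
    (s := s) (by norm_num) hη ha hs (hV s hs (-1) (by norm_num))
  choose! hp1 ep hep hpd using hp
  choose! hq1 eq heq hqd using hq
  set Ψ : ℝ → ℝ := fun s => (travField E2 B 1 s (X s) / (V1 s - 1)
    - travField E2 B (-1) s (X s) / (V1 s - -1)) / 2 with hΨ
  have hΨm : ∀ s ∈ Icc a t, |Ψ s| ≤ m := fun s hs => by
    have a1 := abs_le.1 (hp1 s hs)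
    have a2 := abs_le.1 (hq1 s hs)
    rw [abs_le]
    constructor <;> simp only [hΨ] <;> linarith
  have hΨd : ∀ s ∈ Icc a t, HasDerivWithinAt Ψ (deriv (B s) (X s) + (ep s - eq s) / 2)
      (Icc a t) s := fun s hs =>
    (((hpd s hs).sub (hqd s hs)).div_const 2).congr_deriv (by ring)
  have hee : ∀ s ∈ Icc a t, |(ep s - eq s) / 2| ≤ e₀ := fun s hs => by
    have a1 := abs_le.1 (hep s hs)
    have a2 := abs_le.1 (heq s hs)
    rw [abs_le]
    constructor <;> linarith
  set u : ℝ → ℝ := fun s => (W1 s - V1 s) - V2 s * (Y s - X s) * Ψ s with hu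
  have hη1 : ∀ s ∈ Icc a t, |W1 s - V1 s| ≤ |u s| + R * m * |Y s - X s| := fun s hs => by
    have e : W1 s - V1 s = u s + V2 s * (Y s - X s) * Ψ s := by simp only [hu]; ring
    rw [e]
    refine (abs_add_le _ _).trans (add_le_add le_rfl ?_)
    rw [abs_mul, abs_mul]
    have := (hX.bound s (hsub hs)).2.2
    have := hΨm s hs
    calc |V2 s| * |Y s - X s| * |Ψ s| ≤ R * |Y s - X s| * m := by gcongr
      _ = _ := by ring
  have hud : ∀ s ∈ Icc a t, HasDerivWithinAt u
      ((E1 s (Y s) - E1 s (X s) + (W2 s - V2 s) * B s (Y s))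
        + V2 s * (B s (Y s) - B s (X s) - deriv (B s) (X s) * (Y s - X s))
        - (K2 E2 B s (X s) (V1 s) * (Y s - X s) + V2 s * (W1 s - V1 s)) * Ψ s
        - V2 s * (Y s - X s) * ((ep s - eq s) / 2)) (Icc a t) s := by
    intro s hs
    have hv2 := (hX.deriv_V2 s (hsub hs)).mono hsub
    have hξ := hasDerivWithinAt_sub_X hX.1 hY.1 ha hs
    have hv1 := hasDerivWithinAt_sub_V1 hX.1 hY.1 ha hs
    refine (hv1.sub ((hv2.mul hξ).mul (hΨd s hs))).congr_deriv ?_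
    rw [K1_sub_K1]
    simp only [Pi.mul_apply]
    ring
  have hgron := abs_le_of_backward_gronwall (ξ := fun s => Y s - X s) (u := u) (T := T) hC0 hd
    (by linarith [ht.2]) (fun s hs => hasDerivWithinAt_sub_X hX.1 hY.1 ha hs) hud
    (fun s hs => ?_) (fun s hs => ?_) ?_ ?_ (left_mem_Icc.2 hat)
  · obtain ⟨g1, g2⟩ := hgron
    have g3 : |W1 a - V1 a| ≤ (1 + R * m) * G * d := by
      refine (hη1 a (left_mem_Icc.2 hat)).trans ?_
      calc _ ≤ G * d + R * m * (G * d) := by gcongr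
        _ = _ := by ring
    have g4 : |W2 a - V2 a| ≤ (1 + M * (G + 1)) * d := by
      refine (abs_sub_V2_le hsol hU ht hX.1 hY.1 hx h2 ⟨ha, hat⟩).trans ?_
      calc _ ≤ d + M * (G * d + d) := by gcongr
        _ = _ := by ring
    have p1 : 0 ≤ G * d := by positivity
    have p2 : 0 ≤ (1 + R * m) * G * d := by positivity
    have p3 : 0 ≤ (1 + M * (G + 1)) * d := by positivity
    refine ⟨?_, ?_, ?_⟩ <;> linarith
  · have n1 := abs_nonneg (Y s - X s)
    have n2 := abs_nonneg (u s)
    have n3 : 0 ≤ R * m := by positivity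
    calc |W1 s - V1 s| ≤ |u s| + R * m * |Y s - X s| := hη1 s hs
      _ ≤ (1 + R * m) * (|Y s - X s| + |u s| + d) := by nlinarith
      _ ≤ _ := by gcongr
  · set S := |Y s - X s| + |u s| + d with hS
    have n1 := abs_nonneg (Y s - X s)
    have n2 := abs_nonneg (u s)
    have hxS : |Y s - X s| ≤ S := by linarith
    have hxdS : |Y s - X s| + d ≤ S := by linarith
    have huS : |u s| ≤ S := by linarith
    have hWS : |W1 s - V1 s| ≤ (1 + R * m) * S := by
      refine (hη1 s hs).trans ?_
      calc _ ≤ S + R * m * S := by gcongr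
        _ = _ := by ring
    have hS0 : 0 ≤ S := by positivity
    have b1 := abs_force_sub_le hsol hU ht hX.1 hY.1 hx h2 (hsub hs)
    obtain ⟨-, bV1, bV2⟩ := hX.bound s (hsub hs)
    have bK := hU.K2_le (Icc_subset_Ico_of_lt ht.2 (hsub hs)) (X s) bV1
    have bB := hB s hs
    have bΨ := hΨm s hs
    have be := hee s hs
    have t1 : |E1 s (Y s) - E1 s (X s) + (W2 s - V2 s) * B s (Y s)| ≤ (M + M ^ 2) * S :=
      b1.trans (by gcongr)
    have t2 : |V2 s * (B s (Y s) - B s (X s) - deriv (B s) (X s) * (Y s - X s))| ≤ R * S := by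
      rw [abs_mul]
      exact mul_le_mul bV2 (bB.trans hxS) (abs_nonneg _) hR
    have t3 : |(K2 E2 B s (X s) (V1 s) * (Y s - X s) + V2 s * (W1 s - V1 s)) * Ψ s|
        ≤ (κ * S + R * ((1 + R * m) * S)) * m := by
      rw [abs_mul]
      refine mul_le_mul ((abs_add_le _ _).trans (add_le_add ?_ ?_)) bΨ (abs_nonneg _)
        (by positivity)
      · rw [abs_mul]; exact mul_le_mul bK hxS (abs_nonneg _) hκ0
      · rw [abs_mul]; exact mul_le_mul bV2 hWS (abs_nonneg _) hR
    have t4 : |V2 s * (Y s - X s) * ((ep s - eq s) / 2)| ≤ R * S * e₀ := by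
      rw [abs_mul, abs_mul]
      gcongr
    refine (abs_sub _ _).trans ((add_le_add ((abs_sub _ _).trans (add_le_add
      ((abs_add_le _ _).trans (add_le_add t1 t2)) t3)) t4).trans ?_)
    calc _ = ((M + M ^ 2) + R + κ * m + R * m * (1 + R * m) + R * e₀) * S := by ring
      _ ≤ C * S := by gcongr
  · simp only [hX.X_end, hY.X_end]
    nlinarith
  · have hΨt := hΨm t (right_mem_Icc.2 hat)
    have bV2 := (hX.bound t ⟨ha.trans hat, le_rfl⟩).2.2
    simp only [hu]
    refine (abs_sub _ _).trans ?_
    rw [abs_mul, abs_mul, hX.V1_end, hY.V1_end, hX.X_end, hY.X_end]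
    calc _ ≤ d + R * d * m := by gcongr
      _ = (1 + R * m) * d := by ring
      _ ≤ C * d := by gcongr

end Comparison

/-! ### The phase-space gradient of the density -/

lemma exists_density_lipschitz
    (hf : ContDiffOn ℝ 1 (fun p : ℝ × ℝ × ℝ × ℝ => f p.1 p.2.1 p.2.2.1 p.2.2.2)
      (slab T (ℝ × ℝ × ℝ))) {a : ℝ} (ha : a ∈ Ico 0 T) (R : ℝ) :
    ∃ L, 0 ≤ L ∧ ∀ x v1 v2 y w1 w2 d, (|x| ≤ R ∧ |v1| ≤ R ∧ |v2| ≤ R) →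
      (|y| ≤ R ∧ |w1| ≤ R ∧ |w2| ≤ R) → |y - x| ≤ d → |w1 - v1| ≤ d → |w2 - v2| ≤ d →
      |f a y w1 w2 - f a x v1 v2| ≤ L * d := by
  obtain ⟨L, hL0, hL⟩ := exists_bound_density_gradient hf ha.2 R
  refine ⟨L, hL0, fun x v1 v2 y w1 w2 d hx hy h0 h1 h2 => ?_⟩
  set Q : Set (ℝ × ℝ × ℝ × ℝ) := {a} ×ˢ Icc (-R) R ×ˢ Icc (-R) R ×ˢ Icc (-R) R with hQ
  have hQc : Convex ℝ Q :=
    (convex_singleton a).prod ((convex_Icc _ _).prod ((convex_Icc _ _).prod (convex_Icc _ _)))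
  have hQs : Q ⊆ slab T (ℝ × ℝ × ℝ) := fun p hp => by
    obtain rfl : p.1 = a := hp.1
    exact ⟨ha, mem_univ _⟩
  have key := hQc.norm_image_sub_le_of_norm_hasFDerivWithin_le (C := L)
    (x := (a, x, v1, v2)) (y := (a, y, w1, w2))
    (fun p hp => ((hf.differentiableOn one_ne_zero p (hQs hp)).hasFDerivWithinAt).mono hQs)
    (fun p hp => by
      obtain rfl : p.1 = a := hp.1
      exact (hL p.1 ⟨ha.1, le_rfl⟩ p.2.1 p.2.2.1 p.2.2.2 (abs_le.2 hp.2.1) (abs_le.2 hp.2.2.1)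
        (abs_le.2 hp.2.2.2)).1)
    ⟨rfl, abs_le.1 hx.1, abs_le.1 hx.2.1, abs_le.1 hx.2.2⟩
    ⟨rfl, abs_le.1 hy.1, abs_le.1 hy.2.1, abs_le.1 hy.2.2⟩
  refine key.trans (mul_le_mul_of_nonneg_left ?_ hL0)
  simp [Prod.norm_def, h0, h1, h2]

/-- A pointwise Lipschitz bound for the density in phase space bounds its partial derivatives. -/
lemma gradient_le_of_eventually {t x v1 v2 C : ℝ} (hC : 0 ≤ C)
    (h : ∀ᶠ z : ℝ × ℝ × ℝ in nhds (x, v1, v2),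
      |f t z.1 z.2.1 z.2.2 - f t x v1 v2| ≤ C * ‖z - (x, v1, v2)‖) :
    |dx f t x v1 v2| ≤ C ∧ |dv1 f t x v1 v2| ≤ C ∧ |dv2 f t x v1 v2| ≤ C := by
  refine ⟨norm_deriv_le_of_lip' (f := fun y => f t y v1 v2) hC ?_,
    norm_deriv_le_of_lip' (f := fun y => f t x y v2) hC ?_,
    norm_deriv_le_of_lip' (f := fun y => f t x v1 y) hC ?_⟩
  · have hc : Filter.Tendsto (fun y : ℝ => (y, v1, v2)) (nhds x) (nhds (x, v1, v2)) :=
      Continuous.tendsto (by fun_prop) x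
    filter_upwards [hc.eventually h] with y hy
    simpa [Prod.norm_def] using hy
  · have hc : Filter.Tendsto (fun y : ℝ => (x, y, v2)) (nhds v1) (nhds (x, v1, v2)) :=
      Continuous.tendsto (by fun_prop) v1
    filter_upwards [hc.eventually h] with y hy
    simpa [Prod.norm_def] using hy
  · have hc : Filter.Tendsto (fun y : ℝ => (x, v1, y)) (nhds v2) (nhds (x, v1, v2)) :=
      Continuous.tendsto (by fun_prop) v2
    filter_upwards [hc.eventually h] with y hy
    simpa [Prod.norm_def] using hy

/-- The gradient of the density at `(t,z)` is controlled by its Lipschitz constant at an earlier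
time `a`, provided the characteristic through `(t,z)` avoids the light speed on `[a,t]`. -/
lemma exists_gradient_bound_of_avoids (hsol : IsC1Solution T b f E1 E2 B)
    (hchar : CharacteristicsReachInitialTime T E1 E2 B) {R M : ℝ}
    (hU : HasUniformBounds T f E1 E2 B R M) {η a : ℝ} (hη : 0 < η) (ha : a ∈ Ico 0 T) :
    ∃ C, ∀ {t x v1 v2 : ℝ} {X V1 V2 : ℝ → ℝ}, a ≤ t → t < T → f t x v1 v2 ≠ 0 →
      IsBoundedCharacteristic E1 E2 B R t x v1 v2 X V1 V2 →
      (∀ s ∈ Icc a t, ∀ σ, |σ| = 1 → η ≤ |V1 s - σ|) →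
      |dx f t x v1 v2| ≤ C ∧ |dv1 f t x v1 v2| ≤ C ∧ |dv2 f t x v1 v2| ≤ C := by
  obtain ⟨Γ, hΓ0, hΓ⟩ := exists_uniform_lipschitz_characteristics hsol hU hη
  obtain ⟨L, hL0, hL⟩ := exists_density_lipschitz hsol.contDiff_f ha R
  refine ⟨L * Γ, ?_⟩
  intro t x v1 v2 X V1 V2 hat htT hne hX hV
  have ht : t ∈ Ico 0 T := ⟨ha.1.trans hat, htT⟩
  obtain ⟨Γt, hΓt0, hΓt⟩ := exists_lipschitz_characteristics hsol hU ht
  obtain ⟨r, hr, htaylor⟩ := exists_uniform_taylor hsol.contDiff_B htT R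
  refine gradient_le_of_eventually (by positivity) ?_
  have hcont : Continuous (fun z : ℝ × ℝ × ℝ => f t z.1 z.2.1 z.2.2) :=
    continuousOn_univ.1 (hsol.contDiff_f.continuousOn.comp
      (f := fun z : ℝ × ℝ × ℝ => (t, z)) (by fun_prop) fun _ _ => ⟨ht, mem_univ _⟩)
  have ev1 : ∀ᶠ z : ℝ × ℝ × ℝ in nhds (x, v1, v2), f t z.1 z.2.1 z.2.2 ≠ 0 :=
    hcont.continuousAt.eventually_ne hne
  have ev2 : ∀ᶠ z : ℝ × ℝ × ℝ in nhds (x, v1, v2), Γt * ‖z - (x, v1, v2)‖ < r := by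
    have hc : Continuous fun z : ℝ × ℝ × ℝ => Γt * ‖z - (x, v1, v2)‖ := by fun_prop
    exact hc.continuousAt.eventually_lt continuousAt_const (by simpa using hr)
  filter_upwards [ev1, ev2] with z hz1 hz2
  obtain ⟨y, w1, w2⟩ := z
  obtain ⟨Y, W1, W2, hY⟩ := hU.exists_characteristic hsol hchar ht hz1
  set d := ‖(y, w1, w2) - (x, v1, v2)‖ with hd
  have hdle : |y - x| ≤ d ∧ |w1 - v1| ≤ d ∧ |w2 - v2| ≤ d := by
    have h0 : ‖(y, w1, w2) - (x, v1, v2)‖ ≤ d := hd.ge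
    simpa [Prod.norm_def] using h0
  obtain ⟨d0, d1, d2⟩ := hdle
  have hclose := hΓt hX hY d0 d1 d2
  obtain ⟨c0, c1, c2⟩ := hΓ ht ha.1 hat hX hY hV (fun s hs => by
    have hs0 : s ∈ Icc 0 t := ⟨ha.1.trans hs.1, hs.2⟩
    exact htaylor s hs0 _ _ (hX.bound s hs0).1 (hY.bound s hs0).1
      ((hclose s hs0).trans_lt hz2)) d0 d1 d2
  have ha0 : a ∈ Icc 0 t := ⟨ha.1, hat⟩
  have := hL _ _ _ _ _ _ _ (hX.bound a ha0) (hY.bound a ha0) c0 c1 c2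
  rw [density_eq_of_isCharacteristic hsol htT hX.1 ha0,
    density_eq_of_isCharacteristic hsol htT hY.1 ha0, ← mul_assoc] at this
  exact this

/-- A characteristic that ends with `|v₁|` at distance more than `ε` from `1` keeps distance
`ε / 2` for a time that depends only on `ε` and the bound on the force. -/
lemma IsBoundedCharacteristic.avoids {R M ε a t x v1 v2 : ℝ} {X V1 V2 : ℝ → ℝ}
    (hU : HasUniformBounds T f E1 E2 B R M) (ht : t ∈ Ico 0 T) (ha : 0 ≤ a)
    (hX : IsBoundedCharacteristic E1 E2 B R t x v1 v2 X V1 V2) (hε : ε < |(|v1| - 1)|)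
    (hat : (M + R * M) * (t - a) ≤ ε / 2) {s σ : ℝ} (hs : s ∈ Icc a t) (hσ : |σ| = 1) :
    ε / 2 ≤ |V1 s - σ| := by
  have hs0 : s ∈ Icc 0 t := ⟨ha.trans hs.1, hs.2⟩
  have h1 := (convex_Icc 0 t).norm_image_sub_le_of_norm_hasDerivWithin_le (C := M + R * M)
    hX.deriv_V1 (fun r hr => hU.K1_le (Icc_subset_Ico_of_lt ht.2 hr) _ (hX.bound r hr).2.2) hs0
    (right_mem_Icc.2 ht.1)
  rw [hX.V1_end, Real.norm_eq_abs, Real.norm_eq_abs, abs_of_nonneg (sub_nonneg.2 hs.2)] at h1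
  have hM := hU.M_nonneg
  have hR := hU.R_nonneg
  have h2 : (M + R * M) * (t - s) ≤ (M + R * M) * (t - a) := by
    have := hs.1
    gcongr
  have h3 := abs_abs_sub_abs_le_abs_sub v1 (V1 s)
  have h4 := abs_abs_sub_abs_le_abs_sub (V1 s) σ
  rw [hσ] at h4
  have h5 : |(|v1| - 1)| ≤ |(|v1| - |V1 s|)| + |(|V1 s| - 1)| := abs_sub_le _ _ _
  linarith

lemma exists_bound_gradient (hsol : IsC1Solution T b f E1 E2 B)
    (hchar : CharacteristicsReachInitialTime T E1 E2 B)
    (hf : ∀ t ∈ Ico 0 T, ∀ x v1 v2, 0 ≤ f t x v1 v2) (hT : 0 < T) {R M : ℝ}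
    (hU : HasUniformBounds T f E1 E2 B R M) {ε : ℝ} (hε : 0 < ε) :
    ∃ C, 0 ≤ C ∧ ∀ t ∈ Ico 0 T, ∀ x v1 v2, ε < |(|v1| - 1)| →
      |dx f t x v1 v2| ≤ C ∧ |dv1 f t x v1 v2| ≤ C ∧ |dv2 f t x v1 v2| ≤ C := by
  have hM := hU.M_nonneg
  have hR := hU.R_nonneg
  -- between `a` and `T` the velocity `v₁` changes by at most `ε / 2`
  set κ : ℝ := M + R * M with hκ
  have hκ0 : 0 ≤ κ := by positivity
  set a : ℝ := max 0 (T - ε / (2 * (κ + 1))) with ha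
  have haT : a ∈ Ico 0 T := ⟨le_max_left _ _, max_lt hT (sub_lt_self T (by positivity))⟩
  obtain ⟨C1, hC10, hC1⟩ := exists_bound_density_gradient hsol.contDiff_f haT.2 R
  obtain ⟨C2, hC2⟩ := exists_gradient_bound_of_avoids hsol hchar hU (half_pos hε) haT
  refine ⟨max C1 C2, hC10.trans (le_max_left _ _), fun t ht x v1 v2 hv => ?_⟩
  by_cases hne : f t x v1 v2 = 0
  · obtain ⟨e0, e1, e2⟩ := gradient_eq_zero_of_density_eq_zero (hf t ht) hne
    simp [e0, e1, e2, hC10]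
  rcases le_total t a with hta | hat
  · obtain ⟨s0, s1, s2⟩ := hU.supp t ht x v1 v2 hne
    obtain ⟨-, g0, g1, g2⟩ := hC1 t ⟨ht.1, hta⟩ x v1 v2 s0 s1 s2
    exact ⟨g0.trans (le_max_left _ _), g1.trans (le_max_left _ _), g2.trans (le_max_left _ _)⟩
  · obtain ⟨X, V1, V2, hX⟩ := hU.exists_characteristic hsol hchar ht hne
    have hκt : κ * (t - a) ≤ ε / 2 := by
      have h1 : T - ε / (2 * (κ + 1)) ≤ a := le_max_right _ _
      have h2 : t - a ≤ ε / (2 * (κ + 1)) := by linarith [ht.2]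
      calc κ * (t - a) ≤ (κ + 1) * (ε / (2 * (κ + 1))) :=
            mul_le_mul (by linarith) h2 (sub_nonneg.2 hat) (by positivity)
        _ = ε / 2 := by field_simp
    obtain ⟨g0, g1, g2⟩ := hC2 hat ht.2 hne hX
      (fun s hs σ hσ => hX.avoids hU ht haT.1 hv hκt hs hσ)
    exact ⟨g0.trans (le_max_right _ _), g1.trans (le_max_right _ _), g2.trans (le_max_right _ _)⟩

lemma exists_forall_norm_le_of_hasCompactSupport {E : Type*} [NormedAddCommGroup E] {g : E → ℝ}
    (hg : HasCompactSupport g) : ∃ R, 0 ≤ R ∧ ∀ z, g z ≠ 0 → ‖z‖ ≤ R := by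
  obtain ⟨R, hR⟩ := hg.isCompact.isBounded.exists_norm_le
  exact ⟨max R 0, le_max_right _ _, fun z hz =>
    (hR z (subset_tsupport g hz)).trans (le_max_left _ _)⟩

lemma exists_hasInitialBounds {f0 : ℝ → ℝ → ℝ → ℝ} {E20 B0 : ℝ → ℝ}
    (hf0 : Continuous (fun p : ℝ × ℝ × ℝ => f0 p.1 p.2.1 p.2.2))
    (hf0_supp : HasCompactSupport (fun p : ℝ × ℝ × ℝ => f0 p.1 p.2.1 p.2.2))
    (hf0_nonneg : ∀ x v1 v2, 0 ≤ f0 x v1 v2)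
    (hE20 : Continuous E20) (hE20_supp : HasCompactSupport E20)
    (hB0 : Continuous B0) (hB0_supp : HasCompactSupport B0)
    (hb : Continuous b) (hb_supp : HasCompactSupport b)
    (hf_init : ∀ x v1 v2, f 0 x v1 v2 = f0 x v1 v2)
    (hE2_init : ∀ x, E2 0 x = E20 x) (hB_init : ∀ x, B 0 x = B0 x) :
    ∃ R0 F0, HasInitialBounds b f E2 B R0 F0 := by
  obtain ⟨c1, h1⟩ := hf0_supp.exists_bound_of_continuous hf0
  obtain ⟨c2, h2⟩ := hE20_supp.exists_bound_of_continuous hE20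
  obtain ⟨c3, h3⟩ := hB0_supp.exists_bound_of_continuous hB0
  obtain ⟨r1, hr1, s1⟩ := exists_forall_norm_le_of_hasCompactSupport hf0_supp
  obtain ⟨r2, hr2, s2⟩ := exists_forall_norm_le_of_hasCompactSupport hE20_supp
  obtain ⟨r3, hr3, s3⟩ := exists_forall_norm_le_of_hasCompactSupport hB0_supp
  have k1 : 0 ≤ c1 := (norm_nonneg _).trans (h1 0)
  have k2 : 0 ≤ c2 := (norm_nonneg _).trans (h2 0)
  have k3 : 0 ≤ c3 := (norm_nonneg _).trans (h3 0)
  refine ⟨r1 + r2 + r3, c1 + c2 + c3, by positivity, fun x v1 v2 => ?_, fun x v1 v2 => ?_,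
    fun x v1 v2 hne => ?_, fun x => ?_, fun x => ?_, fun x hx => ?_, fun x hx => ?_, hb, hb_supp⟩
  · rw [hf_init]; exact hf0_nonneg _ _ _
  · have := (le_abs_self _).trans (h1 (x, v1, v2))
    rw [hf_init]; linarith
  · rw [hf_init] at hne
    have := s1 (x, v1, v2) hne
    simp only [Prod.norm_def, sup_le_iff, Real.norm_eq_abs] at this
    exact ⟨by linarith [this.1], by linarith [this.2.1], by linarith [this.2.2]⟩
  · have := h2 x
    rw [Real.norm_eq_abs] at this
    rw [hE2_init]; linarith
  · have := h3 x
    rw [Real.norm_eq_abs] at this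
    rw [hB_init]; linarith
  · rw [hE2_init]
    by_contra hne
    have := s2 x hne
    rw [Real.norm_eq_abs] at this
    linarith
  · rw [hB_init]
    by_contra hne
    have := s3 x hne
    rw [Real.norm_eq_abs] at this
    linarith

end VlasovMaxwell

theorem theorem1
    (T : ℝ) (hT : 0 < T)
    -- initial data and background density
    (f0 : ℝ → ℝ → ℝ → ℝ) (E20 B0 b : ℝ → ℝ)
    (hf0 : ContDiff ℝ 1 (fun p : ℝ × ℝ × ℝ => f0 p.1 p.2.1 p.2.2))
    (hf0_supp : HasCompactSupport (fun p : ℝ × ℝ × ℝ => f0 p.1 p.2.1 p.2.2))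
    (hf0_nonneg : ∀ x v1 v2, 0 ≤ f0 x v1 v2)
    (hE20 : ContDiff ℝ 1 E20) (hE20_supp : HasCompactSupport E20)
    (hB0 : ContDiff ℝ 1 B0) (hB0_supp : HasCompactSupport B0)
    (hb : ContDiff ℝ 1 b) (hb_supp : HasCompactSupport b)
    -- global neutrality
    (hneutral : ∫ x : ℝ, ∫ w : ℝ × ℝ, f0 x w.1 w.2 = ∫ x : ℝ, b x)
    -- the solution
    (f : ℝ → ℝ → ℝ → ℝ → ℝ) (E1 E2 B : ℝ → ℝ → ℝ)
    (hsol : VlasovMaxwell.IsC1Solution T b f E1 E2 B)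
    (hchar : VlasovMaxwell.CharacteristicsReachInitialTime T E1 E2 B)
    (hf_init : ∀ x v1 v2, f 0 x v1 v2 = f0 x v1 v2)
    (hE2_init : ∀ x, E2 0 x = E20 x)
    (hB_init : ∀ x, B 0 x = B0 x) :
    ∀ ε : ℝ, 0 < ε → ∃ C : ℝ, ∀ t ∈ Set.Ico 0 T, ∀ x v1 v2 : ℝ,
      ε < |(|v1| - 1)| →
        |VlasovMaxwell.dx f t x v1 v2|
          + Real.sqrt (VlasovMaxwell.dv1 f t x v1 v2 ^ 2 + VlasovMaxwell.dv2 f t x v1 v2 ^ 2)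
          ≤ C := by
  intro ε hε
  obtain ⟨R0, F0, hI⟩ := VlasovMaxwell.exists_hasInitialBounds hf0.continuous hf0_supp hf0_nonneg
    hE20.continuous hE20_supp hB0.continuous hB0_supp hb.continuous hb_supp hf_init hE2_init hB_init
  obtain ⟨R, M, hU⟩ := VlasovMaxwell.exists_uniformBounds hsol hT hchar hI
  obtain ⟨C, hC0, hC⟩ := VlasovMaxwell.exists_bound_gradient hsol hchar
    (fun t ht x v1 v2 => (hI.density_mem_Icc hsol hchar ht x v1 v2).1) hT hU hε
  refine ⟨C + (C + C), fun t ht x v1 v2 hv => ?_⟩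
  obtain ⟨h0, h1, h2⟩ := hC t ht x v1 v2 hv
  refine add_le_add h0 (Real.sqrt_le_iff.2 ⟨by positivity, ?_⟩)
  nlinarith [sq_le_sq' (abs_le.1 h1).1 (abs_le.1 h1).2, sq_le_sq' (abs_le.1 h2).1 (abs_le.1 h2).2]
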